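/- Graphs are finite directed multigraphs (parallel edges and loops allowed) in which node labels and rootedness may be undefined at some nodes; a node with defined rootedness is either a root node or unrooted. A graph is a TLRG if the label and the rootedness of every node are defined. A rule $\langle L \leftarrow K \to R\rangle$ consists of TLRGs $L,R$, an interface graph $K$, and inclusions of $K$ into $L$ and $R$. It is applied to a TLRG $G$ by choosing an injective morphism $g\colon L\to G$ (preserving sources, targets, labels and rootedness) such that no edge of $G\setminus g(L)$ is incident to a node of $g(L\setminus K)$, deleting $g(L\setminus K)$, disjointly adding $R\setminus K$, and giving the images of those nodes of $K$ whose label (rootedness) is undefined in $K$ the label (rootedness) they have in $R$; the result is taken up to isomorphism. We write $\Rightarrow$ for one such step; $H$ is a normal form of $G$ if $H$ is isomorphic to $G$ or obtained from $G$ by finitely many steps, and no rule applies to $H$. Let the node labels be $\Box,\triangle$ and let $\Box$ be the only edge label. Let $\mathcal R=\{r_0,r_1,r_2\}$, where all edges are labelled $\Box$ and the interfaces have no edges, labels or rootedness: * $r_0$: the left-hand side is an edge from an unrooted $\Box$-node $1$ to a rooted $\Box$-node; the interface is node $1$; the right-hand side is the single node $1$, rooted and labelled $\Box$. * $r_1$: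 the same, except that node $1$ of the left-hand side is labelled $\triangle$. * $r_2$: the left-hand side is an edge from a rooted $\Box$-node $1$ to an unrooted $\Box$-node $2$; the interface consists of the nodes $1,2$; the right-hand side is an edge from the unrooted $\triangle$-node $1$ to the rooted $\Box$-node $2$. An input graph is a TLRG with all labels $\Box$ and exactly one root node. $G^{\ominus}$ denotes $G$ with every node unrooted and everything labelled $\Box$. $L(\mathrm{TREE})$ is the language of unlabelled trees, that is, of the graphs generated from a single unrooted $\Box$-node by the rule that adds a new unrooted $\Box$-node together with a $\Box$-edge from an existing node to it. Theorem (Tree Recognition). Let $G$ be an input graph. 1. There is no infinite sequence $G\Rightarrow G_1\Rightarrow G_2\Rightarrow\cdots$; every derivation from $G$ has length at most $2|V_G|$, and $G$ has a normal form. 2. For every normal form $H$ of $G$: $H$ is (isomorphic to) the single root-node graph labelled $\Box$, without edges, if and only if $G^{\ominus}\in L(\mathrm{TREE})$. 3. For input graphs of bounded degree a normal form is found in linear time. Precisely: let a graph be kept in a store with node records (label, root flag), edge records (source, target, label), for each node the lists of its outgoing and incoming edges (in any order), and the list of root nodes; and let a program be a fixed finite list of instructions using registers for nodes and edges, each unit-cost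 instruction being a jump, a test, a halt instruction, a move along one of these lists or to the source or target of an edge, a relabelling, a change of a root flag, or the deletion of a node or an edge. Then there are one program and a function $C\colon\mathbb N\to\mathbb N$ such that, started on any store holding an input graph $G$, the program halts with the store holding a normal form $H$ of $G$, its store having run through the graphs of a derivation from $G$ to $H$; and if every node of $G$ has degree (indegree plus outdegree) at most $d$, it executes at most $C(d)\cdot|V_G|$ instructions. -/

import Mathlib

namespace GT

/-! ## Graphs and morphisms -/

/-- A finite directed multigraph whose nodes are partially labelled (`lab`) over `LV` and have a
partially defined rootedness (`root`: `some true` is a root node, `some false` is an unrooted node,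
`none` is undefined rootedness), and whose edges are totally labelled over `LE`. -/
structure LGraph (LV LE : Type) where
  V : Type
  E : Type
  finV : Finite V
  finE : Finite E
  src : E → V
  tgt : E → V
  lab : V → Option LV
  edgeLab : E → LE
  root : V → Option Bool

attribute [instance] LGraph.finV LGraph.finE

variable {LV LE : Type}

/-- Totally labelled and totally rooted graphs. -/
def LGraph.IsTLRG (G : LGraph LV LE) : Prop :=
  (∀ v, G.lab v ≠ none) ∧ ∀ v, G.root v ≠ none

/-- Graph morphisms preserve sources, targets and edge labels, and preserve node labels and
rootedness wherever these are defined in the domain. -/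
structure Hom (G H : LGraph LV LE) where
  onV : G.V → H.V
  onE : G.E → H.E
  src_comm : ∀ e, onV (G.src e) = H.src (onE e)
  tgt_comm : ∀ e, onV (G.tgt e) = H.tgt (onE e)
  edgeLab_comm : ∀ e, G.edgeLab e = H.edgeLab (onE e)
  lab_comm : ∀ v a, G.lab v = some a → H.lab (onV v) = some a
  root_comm : ∀ v b, G.root v = some b → H.root (onV v) = some b

def Hom.Injective {G H : LGraph LV LE} (f : Hom G H) : Prop :=
  Function.Injective f.onV ∧ Function.Injective f.onE

/-- `G` and `H` are isomorphic: there are mutually inverse graph morphisms. -/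
def Iso (G H : LGraph LV LE) : Prop :=
  ∃ (f : Hom G H) (f' : Hom H G),
    (∀ v, f'.onV (f.onV v) = v) ∧ (∀ v, f.onV (f'.onV v) = v) ∧
    (∀ e, f'.onE (f.onE e) = e) ∧ (∀ e, f.onE (f'.onE e) = e)

/-- The degree of a node: incoming degree plus outgoing degree (a loop counts twice). -/
noncomputable def LGraph.deg (G : LGraph LV LE) (v : G.V) : ℕ :=
  Nat.card {e : G.E // G.tgt e = v} + Nat.card {e : G.E // G.src e = v}

/-! ## Rules and derivations -/

/-- A rule `L ← K → R`: totally labelled and totally rooted graphs `L`, `R`, an interface graph `K`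
(node labels and rootedness may be undefined), and inclusions of `K` into `L` and `R`. -/
structure Rule (LV LE : Type) where
  L : LGraph LV LE
  K : LGraph LV LE
  R : LGraph LV LE
  left : Hom K L
  right : Hom K R
  L_tlrg : L.IsTLRG
  R_tlrg : R.IsTLRG
  left_inj : left.Injective
  right_inj : right.Injective

/-- The node `v` of `G` is in `g(L \ K)`. -/
def DelV (r : Rule LV LE) {G : LGraph LV LE} (g : Hom r.L G) (v : G.V) : Prop :=
  ∃ x : r.L.V, (¬ ∃ k, r.left.onV k = x) ∧ g.onV x = v

/-- The edge `e` of `G` is in `g(L \ K)`. -/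
def DelE (r : Rule LV LE) {G : LGraph LV LE} (g : Hom r.L G) (e : G.E) : Prop :=
  ∃ x : r.L.E, (¬ ∃ k, r.left.onE k = x) ∧ g.onE x = e

/-- The dangling condition: no edge in `G \ g(L)` is incident to a node in `g(L \ K)`. -/
def Dangling (r : Rule LV LE) {G : LGraph LV LE} (g : Hom r.L G) : Prop :=
  ∀ e : G.E, (¬ ∃ x, g.onE x = e) → ¬ DelV r g (G.src e) ∧ ¬ DelV r g (G.tgt e)

theorem not_delV_src (r : Rule LV LE) {G : LGraph LV LE} (g : Hom r.L G) (hi : g.Injective)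
    (hd : Dangling r g) (e : G.E) (he : ¬ DelE r g e) : ¬ DelV r g (G.src e) := by
  by_cases h : ∃ x, g.onE x = e
  · obtain ⟨x, rfl⟩ := h
    by_cases hk : ∃ k, r.left.onE k = x
    · obtain ⟨k, rfl⟩ := hk
      rintro ⟨y, hy, hyv⟩
      rw [← g.src_comm] at hyv
      have h1 := hi.1 hyv
      rw [← r.left.src_comm] at h1
      exact hy ⟨_, h1.symm⟩
    · exact absurd ⟨x, hk, rfl⟩ he
  · exact (hd e h).1

theorem not_delV_tgt (r : Rule LV LE) {G : LGraph LV LE} (g : Hom r.L G) (hi : g.Injective)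
    (hd : Dangling r g) (e : G.E) (he : ¬ DelE r g e) : ¬ DelV r g (G.tgt e) := by
  by_cases h : ∃ x, g.onE x = e
  · obtain ⟨x, rfl⟩ := h
    by_cases hk : ∃ k, r.left.onE k = x
    · obtain ⟨k, rfl⟩ := hk
      rintro ⟨y, hy, hyv⟩
      rw [← g.tgt_comm] at hyv
      have h1 := hi.1 hyv
      rw [← r.left.tgt_comm] at h1
      exact hy ⟨_, h1.symm⟩
    · exact absurd ⟨x, hk, rfl⟩ he
  · exact (hd e h).2

open Classical in
/-- The intermediate graph `D`: delete `g(L \ K)` from `G`, and undefine the label (the rootedness)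
of the image of every node of `K` whose label (rootedness) is undefined in `K`. -/
noncomputable def interGraph (r : Rule LV LE) {G : LGraph LV LE} (g : Hom r.L G)
    (hi : g.Injective) (hd : Dangling r g) : LGraph LV LE where
  V := {v : G.V // ¬ DelV r g v}
  E := {e : G.E // ¬ DelE r g e}
  finV := inferInstance
  finE := inferInstance
  src e := ⟨G.src e.1, not_delV_src r g hi hd e.1 e.2⟩
  tgt e := ⟨G.tgt e.1, not_delV_tgt r g hi hd e.1 e.2⟩
  lab v := if ∃ k, r.K.lab k = none ∧ g.onV (r.left.onV k) = v.1 then none else G.lab v.1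
  edgeLab e := G.edgeLab e.1
  root v := if ∃ k, r.K.root k = none ∧ g.onV (r.left.onV k) = v.1 then none else G.root v.1

/-- The node `g(k)` of the intermediate graph, for a node `k` of the interface. -/
noncomputable def interNode (r : Rule LV LE) {G : LGraph LV LE} (g : Hom r.L G) (hi : g.Injective)
    (hd : Dangling r g) (k : r.K.V) : (interGraph r g hi hd).V :=
  ⟨g.onV (r.left.onV k), by
    rintro ⟨x, hx, hxv⟩
    exact hx ⟨k, (hi.1 hxv).symm⟩⟩

open Classical in
/-- Where a node of `R` ends up in the result graph: a node coming from `K` is glued to the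
corresponding node of the intermediate graph, and any other node is new. -/
noncomputable def comatchV (r : Rule LV LE) {G : LGraph LV LE} (g : Hom r.L G) (hi : g.Injective)
    (hd : Dangling r g) (w : r.R.V) :
    (interGraph r g hi hd).V ⊕ {w : r.R.V // ¬ ∃ k, r.right.onV k = w} :=
  if h : ∃ k, r.right.onV k = w then Sum.inl (interNode r g hi hd h.choose) else Sum.inr ⟨w, h⟩

open Classical in
/-- The result graph `H`: add `R \ K` disjointly to the intermediate graph `D`, and give the image
of every node of `K` with undefined label (rootedness) the label (rootedness) it has in `R`. -/
noncomputable def resultGraph (r : Rule LV LE) {G : LGraph LV LE} (g : Hom r.L G)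
    (hi : g.Injective) (hd : Dangling r g) : LGraph LV LE where
  V := (interGraph r g hi hd).V ⊕ {w : r.R.V // ¬ ∃ k, r.right.onV k = w}
  E := (interGraph r g hi hd).E ⊕ {e : r.R.E // ¬ ∃ k, r.right.onE k = e}
  finV := inferInstance
  finE := inferInstance
  src := Sum.elim (fun e => Sum.inl ((interGraph r g hi hd).src e))
    (fun e => comatchV r g hi hd (r.R.src e.1))
  tgt := Sum.elim (fun e => Sum.inl ((interGraph r g hi hd).tgt e))
    (fun e => comatchV r g hi hd (r.R.tgt e.1))
  lab := Sum.elim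
    (fun v => if h : ∃ k, r.K.lab k = none ∧ interNode r g hi hd k = v
      then r.R.lab (r.right.onV h.choose) else (interGraph r g hi hd).lab v)
    (fun w => r.R.lab w.1)
  edgeLab := Sum.elim (interGraph r g hi hd).edgeLab (fun e => r.R.edgeLab e.1)
  root := Sum.elim
    (fun v => if h : ∃ k, r.K.root k = none ∧ interNode r g hi hd k = v
      then r.R.root (r.right.onV h.choose) else (interGraph r g hi hd).root v)
    (fun w => r.R.root w.1)

/-- A direct derivation from `G` to `M` with a rule of the set `rs`, up to isomorphism. -/
def Step (rs : Set (Rule LV LE)) (G M : LGraph LV LE) : Prop :=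
  ∃ r ∈ rs, ∃ (g : Hom r.L G) (hi : g.Injective) (hd : Dangling r g),
    Iso M (resultGraph r g hi hd)

/-- `H` is isomorphic to `G` or derived from `G` in one or more direct derivations. -/
def Derives (rs : Set (Rule LV LE)) (G H : LGraph LV LE) : Prop :=
  Iso G H ∨ Relation.TransGen (Step rs) G H

def InNormalForm (rs : Set (Rule LV LE)) (G : LGraph LV LE) : Prop :=
  ¬ ∃ M, Step rs G M

/-- `H` is a normal form of `G`. -/
def IsNormalFormOf (rs : Set (Rule LV LE)) (G H : LGraph LV LE) : Prop :=
  Derives rs G H ∧ InNormalForm rs H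

/-! ## Graph grammars -/

structure Grammar (LV LE : Type) where
  nonterminalV : Set LV
  nonterminalE : Set LE
  rules : Set (Rule LV LE)
  start : LGraph LV LE

/-- The graph language of a grammar, as an isomorphism-closed class of graphs. -/
def Grammar.language (𝒢 : Grammar LV LE) : Set (LGraph LV LE) :=
  {G | Derives 𝒢.rules 𝒢.start G ∧
    (∀ v a, G.lab v = some a → a ∉ 𝒢.nonterminalV) ∧ ∀ e, G.edgeLab e ∉ 𝒢.nonterminalE}

/-! ## Concrete graphs, the tree grammar and the tree recognition rules -/

/-- The one-letter alphabet containing only the empty label. -/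
inductive Blank : Type
  | square
  deriving DecidableEq

/-- The node alphabet of the tree recognition system. -/
inductive NodeLabel : Type
  | square
  | triangle
  deriving DecidableEq

/-- A single node without edges. -/
def oneNode (a : Option LV) (p : Option Bool) : LGraph LV Blank where
  V := Unit
  E := Empty
  finV := inferInstance
  finE := inferInstance
  src := Empty.elim
  tgt := Empty.elim
  lab _ := a
  edgeLab := Empty.elim
  root _ := p

/-- Two nodes `0`, `1` without edges. -/
def twoNodes (a₀ a₁ : Option LV) (p₀ p₁ : Option Bool) : LGraph LV Blank where
  V := Fin 2
  E := Empty
  finV := inferInstance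
  finE := inferInstance
  src := Empty.elim
  tgt := Empty.elim
  lab := ![a₀, a₁]
  edgeLab := Empty.elim
  root := ![p₀, p₁]

/-- Two nodes `0`, `1` with a single edge from `0` to `1`. -/
def oneEdge (a₀ a₁ : LV) (p₀ p₁ : Bool) : LGraph LV Blank where
  V := Fin 2
  E := Unit
  finV := inferInstance
  finE := inferInstance
  src _ := 0
  tgt _ := 1
  lab := ![some a₀, some a₁]
  edgeLab _ := Blank.square
  root := ![some p₀, some p₁]

theorem oneNode_tlrg (a : LV) (p : Bool) : (oneNode (some a) (some p)).IsTLRG :=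
  ⟨fun _ => by simp [oneNode], fun _ => by simp [oneNode]⟩

theorem oneEdge_tlrg (a₀ a₁ : LV) (p₀ p₁ : Bool) : (oneEdge a₀ a₁ p₀ p₁).IsTLRG := by
  constructor <;> intro v <;> change Fin 2 at v <;> fin_cases v <;> simp [oneEdge]

/-- The tree-growing rule: an unrooted node `0` is kept, and a new unrooted node `1` with an edge
from `0` to `1` is added; every label is the empty label. -/
def growRule : Rule Blank Blank where
  L := oneNode (some .square) (some false)
  K := oneNode (some .square) (some false)
  R := oneEdge .square .square false false
  left :=
    { onV := id, onE := id, src_comm := fun e => e.elim, tgt_comm := fun e => e.elim,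
      edgeLab_comm := fun e => e.elim, lab_comm := fun _ _ h => h, root_comm := fun _ _ h => h }
  right :=
    { onV := fun _ => (0 : Fin 2), onE := fun e => e.elim, src_comm := fun e => e.elim,
      tgt_comm := fun e => e.elim, edgeLab_comm := fun e => e.elim,
      lab_comm := fun _ _ h => h, root_comm := fun _ _ h => h }
  L_tlrg := oneNode_tlrg _ _
  R_tlrg := oneEdge_tlrg _ _ _ _
  left_inj := ⟨fun _ _ h => h, fun _ _ h => h⟩
  right_inj := ⟨fun _ _ _ => rfl, fun e => e.elim⟩

/-- The grammar `TREE`. -/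
def treeGrammar : Grammar Blank Blank where
  nonterminalV := ∅
  nonterminalE := ∅
  rules := {growRule}
  start := oneNode (some .square) (some false)

/-- The pruning rules: an edge from an unrooted node `0` labelled `a` to a root node `1` labelled
with the square is removed together with node `1`, and node `0` becomes a root node labelled with
the square. The interface is node `0` without label and with undefined rootedness. -/
def pruneRule (a : NodeLabel) : Rule NodeLabel Blank where
  L := oneEdge a .square false true
  K := oneNode none none
  R := oneNode (some .square) (some true)
  left :=
    { onV := fun _ => (0 : Fin 2), onE := fun e => e.elim, src_comm := fun e => e.elim,
      tgt_comm := fun e => e.elim, edgeLab_comm := fun e => e.elim,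
      lab_comm := fun _ _ h => by simp [oneNode] at h,
      root_comm := fun _ _ h => by simp [oneNode] at h }
  right :=
    { onV := id, onE := id, src_comm := fun e => e.elim, tgt_comm := fun e => e.elim,
      edgeLab_comm := fun e => e.elim,
      lab_comm := fun _ _ h => by simp [oneNode] at h,
      root_comm := fun _ _ h => by simp [oneNode] at h }
  L_tlrg := oneEdge_tlrg _ _ _ _
  R_tlrg := oneNode_tlrg _ _
  left_inj := ⟨fun _ _ _ => rfl, fun e => e.elim⟩
  right_inj := ⟨fun _ _ h => h, fun _ _ h => h⟩

def r0 : Rule NodeLabel Blank := pruneRule .square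

def r1 : Rule NodeLabel Blank := pruneRule .triangle

/-- The pushing rule: along an edge from a root node `0` to an unrooted node `1`, both labelled with
the square, node `0` is relabelled with the triangle and unrooted, and node `1` becomes a root. The
interface consists of the two nodes, without labels and with undefined rootedness. -/
def r2 : Rule NodeLabel Blank where
  L := oneEdge .square .square true false
  K := twoNodes none none none none
  R := oneEdge .triangle .square false true
  left :=
    { onV := id, onE := fun e => e.elim, src_comm := fun e => e.elim,
      tgt_comm := fun e => e.elim, edgeLab_comm := fun e => e.elim,
      lab_comm := fun v _ h => by
        change Fin 2 at v; fin_cases v <;> simp [twoNodes] at h,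
      root_comm := fun v _ h => by
        change Fin 2 at v; fin_cases v <;> simp [twoNodes] at h }
  right :=
    { onV := id, onE := fun e => e.elim, src_comm := fun e => e.elim,
      tgt_comm := fun e => e.elim, edgeLab_comm := fun e => e.elim,
      lab_comm := fun v _ h => by
        change Fin 2 at v; fin_cases v <;> simp [twoNodes] at h,
      root_comm := fun v _ h => by
        change Fin 2 at v; fin_cases v <;> simp [twoNodes] at h }
  L_tlrg := oneEdge_tlrg _ _ _ _
  R_tlrg := oneEdge_tlrg _ _ _ _
  left_inj := ⟨fun _ _ h => h, fun e => e.elim⟩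
  right_inj := ⟨fun _ _ h => h, fun e => e.elim⟩

/-- The rules of the tree recognition system. -/
def treeRules : Set (Rule NodeLabel Blank) := {r0, r1, r2}

/-- An input graph: totally labelled and totally rooted, all labels are squares, and there is
exactly one root node. (The only edge label is the square.) -/
def IsInputGraph (G : LGraph NodeLabel Blank) : Prop :=
  G.IsTLRG ∧ (∀ v, G.lab v = some .square) ∧ ∃! v, G.root v = some true

/-- `G` with every node unrooted and everything labelled with the square. -/
def strip (G : LGraph NodeLabel Blank) : LGraph Blank Blank where
  V := G.V
  E := G.E
  finV := G.finV
  finE := G.finE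
  src := G.src
  tgt := G.tgt
  lab _ := some .square
  edgeLab _ := .square
  root _ := some false

/-- The graph consisting of a single root node labelled with the square. -/
def singleRoot : LGraph NodeLabel Blank := oneNode (some .square) (some true)

/-! ## Cost model

Graphs are kept in a store which supports the usual constant-time accesses, and are processed by
pointer programs: a program is a fixed finite list of instructions working on registers which hold
the address of a node, the address of an edge, or nothing. Each instruction touches a bounded number
of registers, records and list positions, and costs one unit of time. -/

structure NodeRec (LV : Type) where
  lab : LV
  isRoot : Bool

structure EdgeRec (LE : Type) where
  src : ℕ
  tgt : ℕ
  lab : LE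

/-- A graph store: records of nodes and edges at addresses (`none` at unused addresses), the lists
of outgoing and of incoming edges of each node, and the list of root nodes. The lists are thought of
as doubly linked, so that taking the first entry, moving on to the next entry, inserting an entry at
the front and deleting a given entry take constant time. -/
structure Store (LV LE : Type) where
  node : ℕ → Option (NodeRec LV)
  edge : ℕ → Option (EdgeRec LE)
  outAdj : ℕ → List ℕ
  inAdj : ℕ → List ℕ
  roots : List ℕ

/-- The store `S` holds the graph `G`, at some addresses and with the lists in some order. -/
def Store.Represents (S : Store LV LE) (G : LGraph LV LE) : Prop :=
  ∃ (ν : G.V → ℕ) (ε : G.E → ℕ), Function.Injective ν ∧ Function.Injective ε ∧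
    (∀ a, S.node a ≠ none ↔ ∃ v, ν v = a) ∧
    (∀ a, S.edge a ≠ none ↔ ∃ e, ε e = a) ∧
    (∀ v, ∃ x b, G.lab v = some x ∧ G.root v = some b ∧ S.node (ν v) = some ⟨x, b⟩) ∧
    (∀ e, S.edge (ε e) = some ⟨ν (G.src e), ν (G.tgt e), G.edgeLab e⟩) ∧
    (∀ v, (S.outAdj (ν v)).Nodup ∧ ∀ a, a ∈ S.outAdj (ν v) ↔ ∃ e, ε e = a ∧ G.src e = v) ∧
    (∀ v, (S.inAdj (ν v)).Nodup ∧ ∀ a, a ∈ S.inAdj (ν v) ↔ ∃ e, ε e = a ∧ G.tgt e = v) ∧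
    S.roots.Nodup ∧ ∀ a, a ∈ S.roots ↔ ∃ v, ν v = a ∧ G.root v = some true

/-- The entry that follows `a` in a list, if any. -/
def succIn : List ℕ → ℕ → Option ℕ
  | [], _ => none
  | b :: l, a => if b = a then l.head? else succIn l a

/-- Instructions. Registers for nodes (`x`, `y`) and for edges (`e`, `f`) are numbered; `j` is the
number of an instruction of the program. -/
inductive Instr (LV LE : Type) : Type
  /-- load the first root node, or nothing if there is none -/
  | firstRoot (x : ℕ)
  /-- load into `x` the root node after the one in `y` in the list of root nodes -/
  | nextRoot (x y : ℕ)
  /-- load into `e` the first edge with source `x` -/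
  | firstOut (e x : ℕ)
  /-- load into `e` the edge after `f` among the edges with the same source -/
  | nextOut (e f : ℕ)
  /-- load into `e` the first edge with target `x` -/
  | firstIn (e x : ℕ)
  /-- load into `e` the edge after `f` among the edges with the same target -/
  | nextIn (e f : ℕ)
  /-- load into `x` the source of `e` -/
  | source (x e : ℕ)
  /-- load into `x` the target of `e` -/
  | target (x e : ℕ)
  /-- relabel the node `x` -/
  | setLabel (x : ℕ) (a : LV)
  /-- make the node `x` a root node or an unrooted node -/
  | setRoot (x : ℕ) (b : Bool)
  /-- remove the edge `e` from the store -/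
  | delEdge (e : ℕ)
  /-- remove the node `x` from the store -/
  | delNode (x : ℕ)
  | jump (j : ℕ)
  /-- go to `j` if the register `x` holds nothing -/
  | jumpNoNode (x j : ℕ)
  /-- go to `j` if the register `e` holds nothing -/
  | jumpNoEdge (e j : ℕ)
  /-- go to `j` if the registers `x` and `y` hold the same address -/
  | jumpSameNode (x y j : ℕ)
  /-- go to `j` if the node `x` has the label `a` -/
  | jumpLabel (x : ℕ) (a : LV) (j : ℕ)
  /-- go to `j` if the edge `e` has the label `a` -/
  | jumpEdgeLabel (e : ℕ) (a : LE) (j : ℕ)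
  /-- go to `j` if the node `x` is a root node -/
  | jumpRoot (x j : ℕ)
  | halt

/-- A program is a finite list of instructions. -/
abbrev Program (LV LE : Type) := List (Instr LV LE)

structure Config (LV LE : Type) where
  pc : ℕ
  nreg : ℕ → Option ℕ
  ereg : ℕ → Option ℕ
  store : Store LV LE

namespace Config

def next (c : Config LV LE) : Config LV LE := { c with pc := c.pc + 1 }

def goto (c : Config LV LE) (j : ℕ) : Config LV LE := { c with pc := j }

def setN (c : Config LV LE) (x : ℕ) (a : Option ℕ) : Config LV LE :=
  { c with nreg := Function.update c.nreg x a }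

def setE (c : Config LV LE) (e : ℕ) (a : Option ℕ) : Config LV LE :=
  { c with ereg := Function.update c.ereg e a }

def setS (c : Config LV LE) (S : Store LV LE) : Config LV LE := { c with store := S }

/-- The address held by a node register together with the record stored there. -/
def nodeAt (c : Config LV LE) (x : ℕ) : Option (ℕ × NodeRec LV) :=
  (c.nreg x).bind fun a => (c.store.node a).map fun n => (a, n)

/-- The address held by an edge register together with the record stored there. -/
def edgeAt (c : Config LV LE) (e : ℕ) : Option (ℕ × EdgeRec LE) :=
  (c.ereg e).bind fun a => (c.store.edge a).map fun d => (a, d)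

end Config

namespace Store

def setLabel (S : Store LV LE) (a : ℕ) (n : NodeRec LV) (x : LV) : Store LV LE :=
  { S with node := Function.update S.node a (some { n with lab := x }) }

def setRoot (S : Store LV LE) (a : ℕ) (n : NodeRec LV) (b : Bool) : Store LV LE :=
  { S with
    node := Function.update S.node a (some { n with isRoot := b })
    roots := if b then (if n.isRoot then S.roots else a :: S.roots) else S.roots.erase a }

def delEdge (S : Store LV LE) (a : ℕ) (d : EdgeRec LE) : Store LV LE :=
  { S with
    edge := Function.update S.edge a none
    outAdj := Function.update S.outAdj d.src ((S.outAdj d.src).erase a)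
    inAdj := Function.update S.inAdj d.tgt ((S.inAdj d.tgt).erase a) }

def delNode (S : Store LV LE) (a : ℕ) : Store LV LE :=
  { S with
    node := Function.update S.node a none
    roots := S.roots.erase a }

end Store

/-- The effect of one instruction on a configuration. The result is `none` for `halt`, and when an
instruction follows a register that holds nothing or the address of a removed node or edge. -/
def exec [DecidableEq LV] [DecidableEq LE] (c : Config LV LE) : Instr LV LE → Option (Config LV LE)
  | .firstRoot x => some (c.setN x c.store.roots.head?).next
  | .nextRoot x y => (c.nodeAt y).map fun p => (c.setN x (succIn c.store.roots p.1)).next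
  | .firstOut e x => (c.nodeAt x).map fun p => (c.setE e (c.store.outAdj p.1).head?).next
  | .nextOut e f =>
      (c.edgeAt f).map fun p => (c.setE e (succIn (c.store.outAdj p.2.src) p.1)).next
  | .firstIn e x => (c.nodeAt x).map fun p => (c.setE e (c.store.inAdj p.1).head?).next
  | .nextIn e f =>
      (c.edgeAt f).map fun p => (c.setE e (succIn (c.store.inAdj p.2.tgt) p.1)).next
  | .source x e => (c.edgeAt e).map fun p => (c.setN x (some p.2.src)).next
  | .target x e => (c.edgeAt e).map fun p => (c.setN x (some p.2.tgt)).next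
  | .setLabel x a => (c.nodeAt x).map fun p => (c.setS (c.store.setLabel p.1 p.2 a)).next
  | .setRoot x b => (c.nodeAt x).map fun p => (c.setS (c.store.setRoot p.1 p.2 b)).next
  | .delEdge e => (c.edgeAt e).map fun p => (c.setS (c.store.delEdge p.1 p.2)).next
  | .delNode x => (c.nodeAt x).map fun p => (c.setS (c.store.delNode p.1)).next
  | .jump j => some (c.goto j)
  | .jumpNoNode x j => some (if c.nreg x = none then c.goto j else c.next)
  | .jumpNoEdge e j => some (if c.ereg e = none then c.goto j else c.next)
  | .jumpSameNode x y j => some (if c.nreg x = c.nreg y then c.goto j else c.next)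
  | .jumpLabel x a j => (c.nodeAt x).map fun p => if p.2.lab = a then c.goto j else c.next
  | .jumpEdgeLabel e a j => (c.edgeAt e).map fun p => if p.2.lab = a then c.goto j else c.next
  | .jumpRoot x j => (c.nodeAt x).map fun p => if p.2.isRoot then c.goto j else c.next
  | .halt => none

/-- The initial configuration on a store: the first instruction is next, all registers are empty. -/
def Config.init (S : Store LV LE) : Config LV LE := ⟨0, fun _ => none, fun _ => none, S⟩

/-- The configuration of `P` after `t` executed instructions, started on the store `S`; `none` if
fewer than `t` instructions can be executed. -/
def Program.after [DecidableEq LV] [DecidableEq LE] (P : Program LV LE) (S : Store LV LE) :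
    ℕ → Option (Config LV LE)
  | 0 => some (Config.init S)
  | t + 1 => (Program.after P S t).bind fun c => (P[c.pc]?).bind (exec c)

/-- Started on `S`, the program reaches a `halt` instruction after exactly `n` executed
instructions, and the store is `S'` at that time. -/
def Program.HaltsIn [DecidableEq LV] [DecidableEq LE] (P : Program LV LE) (S : Store LV LE) (n : ℕ)
    (S' : Store LV LE) : Prop :=
  ∃ c, P.after S n = some c ∧ P[c.pc]? = some .halt ∧ c.store = S'

/-- After `t` executed instructions on `S`, the store of the program holds the graph `G`. -/
def Program.HoldsAt [DecidableEq LV] [DecidableEq LE] (P : Program LV LE) (S : Store LV LE) (t : ℕ)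
    (G : LGraph LV LE) : Prop :=
  ∃ c, P.after S t = some c ∧ c.store.Represents G

/-- Started on a store holding `G`, the program runs the system `rs` on `G`: it halts after `n`
instructions, its store runs through the graphs of a derivation `G = D 0 ⇒ D 1 ⇒ ⋯ ⇒ D k = H` at
times `0 = τ 0 < τ 1 < ⋯ < τ k ≤ n`, and when it halts its store holds `H`. -/
def Program.RunsSystem [DecidableEq LV] [DecidableEq LE] (P : Program LV LE)
    (rs : Set (Rule LV LE)) (S : Store LV LE) (G H : LGraph LV LE) (n : ℕ) : Prop :=
  (∃ S', P.HaltsIn S n S' ∧ S'.Represents H) ∧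
  ∃ (k : ℕ) (D : ℕ → LGraph LV LE) (τ : ℕ → ℕ), D 0 = G ∧ D k = H ∧ τ 0 = 0 ∧ τ k ≤ n ∧
    (∀ i < k, Step rs (D i) (D (i + 1)) ∧ τ i < τ (i + 1)) ∧
    ∀ i ≤ k, P.HoldsAt S (τ i) (D i)

end GT

/-!
The rules move a single root node through the graph in a depth-first manner: `r2` pushes it along an
edge to a fresh square and leaves a triangle behind, and `r0`, `r1` delete it when it has become a
leaf and move back to its parent. Up to isomorphism, a step is one of two explicit operations on an
edge, `pushGraph` and `pruneGraph` (`step_iff`).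

*Termination.* Pushing loses a square. Pruning loses a node, and the number of squares does not
grow. Hence the number of nodes plus the number of squares, which is at most `2 * |V|`, decreases in
every step (`Step.weight_lt`).

*Recognition.* Read backwards, a pruning attaches a leaf to the underlying unlabelled graph and a
push leaves it as it is, so that a graph which is reduced to a single node is generated by the tree
grammar (`strip_mem_language_of_derives`). Conversely, let the input be a tree. Being a tree is
expressed by `IsTree`, which holds throughout the language and survives pruning. During a run
every triangle has a child that is a triangle or the root node (`TrianglesLead`), hence all
triangles lie strictly above the root node. When no rule applies, the root node therefore has no
children: a child is an unrooted node, and it is no square because of `r2`. It has no parent either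
because of `r0` and `r1`, so it is the whole tree (`IsTreeState.iso_singleRoot`).

*Linear time.* The program `treeProgram` repeatedly loads the root node, scans its outgoing edges
for one to push along, and if there are none at all prunes the root node, provided that it has
exactly one incoming edge. One round needs time linear in the degree of the root node and performs
one step or establishes a normal form (`run_round`); steps do not increase degrees, and their number
is bounded by the weight of the input (`run_normalForm`).
-/

namespace GT

variable {LV LE : Type}

/-! ### Isomorphisms -/

/-- Isomorphic graphs are related by bijections on nodes and edges that commute with all the
structure. In particular undefined labels correspond to undefined labels, because the inverse
preserves labels as well. -/
theorem iso_iff {G H : LGraph LV LE} :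
    Iso G H ↔ ∃ (φ : G.V ≃ H.V) (ψ : G.E ≃ H.E),
      (∀ e, φ (G.src e) = H.src (ψ e)) ∧ (∀ e, φ (G.tgt e) = H.tgt (ψ e)) ∧
      (∀ e, G.edgeLab e = H.edgeLab (ψ e)) ∧ (∀ v, H.lab (φ v) = G.lab v) ∧
      ∀ v, H.root (φ v) = G.root v := by
  constructor
  · rintro ⟨f, f', h1, h2, h3, h4⟩
    refine ⟨⟨f.onV, f'.onV, h1, h2⟩, ⟨f.onE, f'.onE, h3, h4⟩, f.src_comm, f.tgt_comm,
      f.edgeLab_comm, fun v => ?_, fun v => ?_⟩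
    · refine Option.ext fun a => ⟨fun h => ?_, f.lab_comm v a⟩
      simpa [h1] using f'.lab_comm _ _ h
    · refine Option.ext fun a => ⟨fun h => ?_, f.root_comm v a⟩
      simpa [h1] using f'.root_comm _ _ h
  · rintro ⟨φ, ψ, hs, ht, he, hl, hr⟩
    refine ⟨⟨φ, ψ, hs, ht, he, fun v a h => by rw [hl, h], fun v b h => by rw [hr, h]⟩,
      ⟨φ.symm, ψ.symm, fun e => ?_, fun e => ?_, fun e => ?_, fun v a h => ?_, fun v b h => ?_⟩,
      by simp, by simp, by simp, by simp⟩
    · rw [Equiv.symm_apply_eq, hs]; simp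
    · rw [Equiv.symm_apply_eq, ht]; simp
    · rw [he]; simp
    · rw [← hl]; simpa using h
    · rw [← hr]; simpa using h

theorem Iso.of_bijective {G H : LGraph LV LE} (f : G.V → H.V) (f' : G.E → H.E)
    (hf : f.Bijective) (hf' : f'.Bijective) (hs : ∀ e, f (G.src e) = H.src (f' e))
    (ht : ∀ e, f (G.tgt e) = H.tgt (f' e)) (he : ∀ e, G.edgeLab e = H.edgeLab (f' e))
    (hl : ∀ v, H.lab (f v) = G.lab v) (hr : ∀ v, H.root (f v) = G.root v) : Iso G H :=
  iso_iff.2 ⟨Equiv.ofBijective f hf, Equiv.ofBijective f' hf', hs, ht, he, hl, hr⟩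

theorem Iso.refl (G : LGraph LV LE) : Iso G G :=
  iso_iff.2 ⟨Equiv.refl _, Equiv.refl _, by simp, by simp, by simp, by simp, by simp⟩

theorem Iso.symm {G H : LGraph LV LE} : Iso G H → Iso H G := by
  rintro ⟨f, f', h1, h2, h3, h4⟩
  exact ⟨f', f, h2, h1, h4, h3⟩

theorem Iso.trans {G H M : LGraph LV LE} (h : Iso G H) (h' : Iso H M) : Iso G M := by
  obtain ⟨φ, ψ, hs, ht, he, hl, hr⟩ := iso_iff.1 h
  obtain ⟨φ', ψ', hs', ht', he', hl', hr'⟩ := iso_iff.1 h'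
  exact iso_iff.2 ⟨φ.trans φ', ψ.trans ψ', by simp [hs, hs'], by simp [ht, ht'],
    by simp [he, he'], by simp [hl, hl'], by simp [hr, hr']⟩

/-! ### The result of applying a rule -/

section Result

variable (r : Rule LV LE) {G : LGraph LV LE} (g : Hom r.L G) (hi : g.Injective) (hd : Dangling r g)

theorem interNode_injective : Function.Injective (interNode r g hi hd) := fun _ _ h =>
  r.left_inj.1 (hi.1 (congrArg Subtype.val h))

theorem comatchV_right (k : r.K.V) :
    comatchV r g hi hd (r.right.onV k) = Sum.inl (interNode r g hi hd k) := by
  have h : ∃ k', r.right.onV k' = r.right.onV k := ⟨k, rfl⟩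
  rw [comatchV, dif_pos h, r.right_inj.1 h.choose_spec]

theorem comatchV_new (w : r.R.V) (h : ¬ ∃ k, r.right.onV k = w) :
    comatchV r g hi hd w = Sum.inr ⟨w, h⟩ := by
  rw [comatchV, dif_neg h]

theorem resultGraph_lab_interNode (k : r.K.V) (hk : r.K.lab k = none) :
    (resultGraph r g hi hd).lab (Sum.inl (interNode r g hi hd k)) = r.R.lab (r.right.onV k) := by
  have h : ∃ k', r.K.lab k' = none ∧ interNode r g hi hd k' = interNode r g hi hd k := ⟨k, hk, rfl⟩
  simp only [resultGraph, Sum.elim_inl]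
  rw [dif_pos h, interNode_injective r g hi hd h.choose_spec.2]

theorem resultGraph_root_interNode (k : r.K.V) (hk : r.K.root k = none) :
    (resultGraph r g hi hd).root (Sum.inl (interNode r g hi hd k)) = r.R.root (r.right.onV k) := by
  have h : ∃ k', r.K.root k' = none ∧ interNode r g hi hd k' = interNode r g hi hd k :=
    ⟨k, hk, rfl⟩
  simp only [resultGraph, Sum.elim_inl]
  rw [dif_pos h, interNode_injective r g hi hd h.choose_spec.2]

theorem resultGraph_lab_of_forall_ne (v : (interGraph r g hi hd).V)
    (hv : ∀ k, r.K.lab k = none → g.onV (r.left.onV k) ≠ v.1) :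
    (resultGraph r g hi hd).lab (Sum.inl v) = G.lab v.1 := by
  refine (dif_neg ?_).trans (if_neg fun ⟨k, hk, h⟩ => hv k hk h)
  rintro ⟨k, hk, rfl⟩
  exact hv k hk rfl

theorem resultGraph_root_of_forall_ne (v : (interGraph r g hi hd).V)
    (hv : ∀ k, r.K.root k = none → g.onV (r.left.onV k) ≠ v.1) :
    (resultGraph r g hi hd).root (Sum.inl v) = G.root v.1 := by
  refine (dif_neg ?_).trans (if_neg fun ⟨k, hk, h⟩ => hv k hk h)
  rintro ⟨k, hk, rfl⟩
  exact hv k hk rfl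

end Result

/-! ### The results of the concrete rules -/

/-- The match of a one-edge graph on the edge `e`. -/
def edgeHom {G : LGraph LV Blank} (e : G.E) {a₀ a₁ : LV} {p₀ p₁ : Bool}
    (h₀ : G.lab (G.src e) = some a₀) (h₁ : G.lab (G.tgt e) = some a₁)
    (k₀ : G.root (G.src e) = some p₀) (k₁ : G.root (G.tgt e) = some p₁) :
    Hom (oneEdge a₀ a₁ p₀ p₁) G where
  onV := ![G.src e, G.tgt e]
  onE _ := e
  src_comm _ := rfl
  tgt_comm _ := rfl
  edgeLab_comm _ := rfl
  lab_comm v a h := by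
    change Fin 2 at v
    fin_cases v
    · exact h₀.trans h
    · exact h₁.trans h
  root_comm v a h := by
    change Fin 2 at v
    fin_cases v
    · exact k₀.trans h
    · exact k₁.trans h

theorem edgeHom_injective {G : LGraph LV Blank} (e : G.E) {a₀ a₁ : LV} {p₀ p₁ : Bool}
    (h₀ : G.lab (G.src e) = some a₀) (h₁ : G.lab (G.tgt e) = some a₁)
    (k₀ : G.root (G.src e) = some p₀) (k₁ : G.root (G.tgt e) = some p₁)
    (hp : p₀ ≠ p₁) : (edgeHom e h₀ h₁ k₀ k₁).Injective := by
  have hne : G.src e ≠ G.tgt e := fun h => hp (by simpa [h, k₁] using k₀.symm)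
  refine ⟨fun v w h => ?_, fun _ _ _ => rfl⟩
  change Fin 2 at v w
  fin_cases v <;> fin_cases w
  · rfl
  · exact (hne h).elim
  · exact (hne h.symm).elim
  · rfl

open Classical in
/-- The effect of `r2` on an edge from `x` to `y`. No label changes at `y`, which has to be
labelled with the square before. -/
noncomputable def pushGraph (G : LGraph NodeLabel Blank) (x y : G.V) : LGraph NodeLabel Blank where
  V := G.V
  E := G.E
  finV := G.finV
  finE := G.finE
  src := G.src
  tgt := G.tgt
  lab v := if v = x then some .triangle else G.lab v
  edgeLab := G.edgeLab
  root v := if v = x then some false else if v = y then some true else G.root v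

/-- No edge other than `e` is incident to the target of `e`. -/
def IsPendant (G : LGraph LV LE) (e : G.E) : Prop :=
  ∀ e', e' ≠ e → G.src e' ≠ G.tgt e ∧ G.tgt e' ≠ G.tgt e

open Classical in
/-- The effect of `r0` and `r1` on a pendant edge `e`: delete `e` with its target, and make the
source a root labelled with the square. -/
noncomputable def pruneGraph (G : LGraph NodeLabel Blank) (e : G.E) (hp : IsPendant G e) :
    LGraph NodeLabel Blank where
  V := {v : G.V // v ≠ G.tgt e}
  E := {e' : G.E // e' ≠ e}
  finV := inferInstance
  finE := inferInstance
  src e' := ⟨G.src e'.1, (hp e'.1 e'.2).1⟩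
  tgt e' := ⟨G.tgt e'.1, (hp e'.1 e'.2).2⟩
  lab v := if v.1 = G.src e then some .square else G.lab v.1
  edgeLab e' := G.edgeLab e'.1
  root v := if v.1 = G.src e then some true else G.root v.1

/-- The graph `G` with a new leaf attached to the node `p`. -/
def growGraph (G : LGraph Blank Blank) (p : G.V) : LGraph Blank Blank where
  V := Option G.V
  E := Option G.E
  finV := inferInstance
  finE := inferInstance
  src e := some (e.elim p G.src)
  tgt e := e.map G.tgt
  lab v := v.elim (some .square) G.lab
  edgeLab _ := .square
  root v := v.elim (some false) G.root

theorem push_iso (G : LGraph NodeLabel Blank) (g : Hom r2.L G) (hi : g.Injective)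
    (hd : Dangling r2 g) :
    Iso (resultGraph r2 g hi hd) (pushGraph G (g.onV (0 : Fin 2)) (g.onV (1 : Fin 2))) := by
  have hV : ∀ v, ¬ DelV r2 g v := fun v ⟨x, hx, _⟩ => hx ⟨x, rfl⟩
  have hE : ∀ e, DelE r2 g e ↔ e = g.onE () := fun e =>
    ⟨fun ⟨x, _, h⟩ => h.symm, fun h => ⟨(), fun ⟨k, _⟩ => k.elim, h.symm⟩⟩
  have hne : g.onV (1 : Fin 2) ≠ g.onV (0 : Fin 2) := fun h => by
    have := hi.1 h
    exact absurd (show (1 : Fin 2) = 0 from this) (by decide)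
  have l0 := resultGraph_lab_interNode r2 g hi hd (0 : Fin 2) rfl
  have l1 := resultGraph_lab_interNode r2 g hi hd (1 : Fin 2) rfl
  have t0 := resultGraph_root_interNode r2 g hi hd (0 : Fin 2) rfl
  have t1 := resultGraph_root_interNode r2 g hi hd (1 : Fin 2) rfl
  have hn : ∀ w : r2.R.V, ∃ k, r2.right.onV k = w := fun w => ⟨w, rfl⟩
  have cases3 : ∀ v : (interGraph r2 g hi hd).V, v = interNode r2 g hi hd (0 : Fin 2) ∨
      v = interNode r2 g hi hd (1 : Fin 2) ∨
      (v.1 ≠ g.onV (0 : Fin 2) ∧ v.1 ≠ g.onV (1 : Fin 2)) := by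
    intro v
    by_cases h0 : v.1 = g.onV (0 : Fin 2)
    · exact Or.inl (Subtype.ext h0)
    by_cases h1 : v.1 = g.onV (1 : Fin 2)
    · exact Or.inr (Or.inl (Subtype.ext h1))
    exact Or.inr (Or.inr ⟨h0, h1⟩)
  have hk : ∀ v : G.V, v ≠ g.onV (0 : Fin 2) → v ≠ g.onV (1 : Fin 2) →
      ∀ k : r2.K.V, g.onV (r2.left.onV k) ≠ v := by
    intro v h0 h1 k
    change Fin 2 at k
    fin_cases k
    · exact h0.symm
    · exact h1.symm
  refine Iso.of_bijective (Sum.elim Subtype.val fun w => (w.2 (hn _)).elim)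
    (Sum.elim Subtype.val fun _ => g.onE ()) ⟨?_, ?_⟩ ⟨?_, ?_⟩ ?_ ?_ ?_ ?_ ?_
  · rintro (v | w) (v' | w') h
    · exact congrArg Sum.inl (Subtype.ext h)
    · exact (w'.2 (hn _)).elim
    · exact (w.2 (hn _)).elim
    · exact (w.2 (hn _)).elim
  · exact fun v => ⟨Sum.inl ⟨v, hV v⟩, rfl⟩
  · rintro (e | e) (e' | e') h
    · exact congrArg Sum.inl (Subtype.ext h)
    · exact (e.2 ((hE _).2 h)).elim
    · exact (e'.2 ((hE _).2 h.symm)).elim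
    · exact congrArg Sum.inr (Subtype.ext rfl)
  · intro e
    by_cases h : e = g.onE ()
    · exact ⟨Sum.inr ⟨(), fun ⟨k, _⟩ => k.elim⟩, h.symm⟩
    · exact ⟨Sum.inl ⟨e, fun h' => h ((hE _).1 h')⟩, rfl⟩
  · rintro (e | e)
    · rfl
    · exact (congrArg _ (comatchV_right r2 g hi hd (0 : Fin 2))).trans (g.src_comm ())
  · rintro (e | e)
    · rfl
    · exact (congrArg _ (comatchV_right r2 g hi hd (1 : Fin 2))).trans (g.tgt_comm ())
  · exact fun _ => rfl
  · rintro (v | w)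
    · rcases cases3 v with rfl | rfl | ⟨h0, h1⟩
      · exact (if_pos rfl).trans l0.symm
      · exact (if_neg hne).trans ((g.lab_comm (1 : Fin 2) _ rfl).trans l1.symm)
      · exact (if_neg h0).trans
          (resultGraph_lab_of_forall_ne r2 g hi hd v fun k _ => hk _ h0 h1 k).symm
    · exact (w.2 (hn _)).elim
  · rintro (v | w)
    · rcases cases3 v with rfl | rfl | ⟨h0, h1⟩
      · exact (if_pos rfl).trans t0.symm
      · exact (if_neg hne).trans ((if_pos rfl).trans t1.symm)
      · exact (if_neg h0).trans ((if_neg h1).trans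
          (resultGraph_root_of_forall_ne r2 g hi hd v fun k _ => hk _ h0 h1 k).symm)
    · exact (w.2 (hn _)).elim

theorem prune_iso (a : NodeLabel) (G : LGraph NodeLabel Blank) (g : Hom (pruneRule a).L G)
    (hi : g.Injective) (hd : Dangling (pruneRule a) g) (hp : IsPendant G (g.onE ())) :
    Iso (resultGraph (pruneRule a) g hi hd) (pruneGraph G (g.onE ()) hp) := by
  have ht : g.onV (1 : Fin 2) = G.tgt (g.onE ()) := g.tgt_comm ()
  have hs : g.onV (0 : Fin 2) = G.src (g.onE ()) := g.src_comm ()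
  have hV : ∀ v, DelV (pruneRule a) g v ↔ v = G.tgt (g.onE ()) := by
    refine fun v => ⟨fun ⟨x, hx, h⟩ => ?_, fun h => ⟨(1 : Fin 2), ?_, ht.trans h.symm⟩⟩
    · change Fin 2 at x
      fin_cases x
      · exact (hx ⟨(), rfl⟩).elim
      · exact h.symm.trans ht
    · rintro ⟨k, hk⟩
      exact absurd (show (0 : Fin 2) = 1 from hk) (by decide)
  have hE : ∀ e, DelE (pruneRule a) g e ↔ e = g.onE () := fun e =>
    ⟨fun ⟨x, _, h⟩ => h.symm, fun h => ⟨(), fun ⟨k, _⟩ => k.elim, h.symm⟩⟩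
  have l0 := resultGraph_lab_interNode (pruneRule a) g hi hd () rfl
  have t0 := resultGraph_root_interNode (pruneRule a) g hi hd () rfl
  have hn : ∀ w : (pruneRule a).R.V, ∃ k, (pruneRule a).right.onV k = w := fun w => ⟨w, rfl⟩
  have hk : ∀ v : G.V, v ≠ G.src (g.onE ()) →
      ∀ k : (pruneRule a).K.V, g.onV ((pruneRule a).left.onV k) ≠ v := by
    rintro v h0 k rfl
    exact h0 hs
  refine Iso.of_bijective
    (Sum.elim (fun v => ⟨v.1, fun h => v.2 ((hV _).2 h)⟩) fun w => (w.2 (hn _)).elim)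
    (Sum.elim (fun e => ⟨e.1, fun h => e.2 ((hE _).2 h)⟩) fun e => Empty.elim e.1)
    ⟨?_, ?_⟩ ⟨?_, ?_⟩ ?_ ?_ ?_ ?_ ?_
  · rintro (v | w) (v' | w') h
    · exact congrArg Sum.inl (Subtype.ext (Subtype.mk.inj h))
    · exact (w'.2 (hn _)).elim
    · exact (w.2 (hn _)).elim
    · exact (w.2 (hn _)).elim
  · exact fun v => ⟨Sum.inl ⟨v.1, fun h => v.2 ((hV _).1 h)⟩, rfl⟩
  · rintro (e | e) (e' | e') h
    · exact congrArg Sum.inl (Subtype.ext (Subtype.mk.inj h))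
    · exact Empty.elim e'.1
    · exact Empty.elim e.1
    · exact Empty.elim e.1
  · exact fun e => ⟨Sum.inl ⟨e.1, fun h => e.2 ((hE _).1 h)⟩, rfl⟩
  · rintro (e | e)
    · rfl
    · exact Empty.elim e.1
  · rintro (e | e)
    · rfl
    · exact Empty.elim e.1
  · exact fun _ => rfl
  · rintro (v | w)
    · by_cases h : v.1 = G.src (g.onE ())
      · obtain rfl : v = interNode (pruneRule a) g hi hd () := Subtype.ext (h.trans hs.symm)
        exact (if_pos h).trans l0.symm
      · exact (if_neg h).trans
          (resultGraph_lab_of_forall_ne _ g hi hd v fun k _ => hk _ h k).symm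
    · exact (w.2 (hn _)).elim
  · rintro (v | w)
    · by_cases h : v.1 = G.src (g.onE ())
      · obtain rfl : v = interNode (pruneRule a) g hi hd () := Subtype.ext (h.trans hs.symm)
        exact (if_pos h).trans t0.symm
      · exact (if_neg h).trans
          (resultGraph_root_of_forall_ne _ g hi hd v fun k _ => hk _ h k).symm
    · exact (w.2 (hn _)).elim

theorem grow_iso (G : LGraph Blank Blank) (g : Hom growRule.L G)
    (hi : g.Injective) (hd : Dangling growRule g) :
    Iso (resultGraph growRule g hi hd) (growGraph G (g.onV ())) := by
  have hV : ∀ v, ¬ DelV growRule g v := fun v ⟨x, hx, _⟩ => hx ⟨x, rfl⟩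
  have hE : ∀ e, ¬ DelE growRule g e := fun e ⟨x, _, _⟩ => Empty.elim x
  have h1 : ¬ ∃ k, growRule.right.onV k = (1 : Fin 2) := by
    rintro ⟨k, hk⟩
    exact absurd (show (0 : Fin 2) = 1 from hk) (by decide)
  have hw : ∀ w : {w : growRule.R.V // ¬ ∃ k, growRule.right.onV k = w}, w.1 = (1 : Fin 2) := by
    rintro ⟨w, hw⟩
    change Fin 2 at w
    fin_cases w
    · exact (hw ⟨(), rfl⟩).elim
    · rfl
  refine Iso.of_bijective (Sum.elim (fun v => some v.1) fun _ => none)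
    (Sum.elim (fun e => some e.1) fun _ => none) ⟨?_, ?_⟩ ⟨?_, ?_⟩ ?_ ?_ ?_ ?_ ?_
  · rintro (v | w) (v' | w') h
    · exact congrArg Sum.inl (Subtype.ext (Option.some.inj h))
    · exact (Option.some_ne_none _ h).elim
    · exact (Option.some_ne_none _ h.symm).elim
    · exact congrArg Sum.inr (Subtype.ext ((hw w).trans (hw w').symm))
  · rintro (_ | v)
    · exact ⟨Sum.inr ⟨(1 : Fin 2), h1⟩, rfl⟩
    · exact ⟨Sum.inl ⟨v, hV v⟩, rfl⟩
  · rintro (e | e) (e' | e') h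
    · exact congrArg Sum.inl (Subtype.ext (Option.some.inj h))
    · exact (Option.some_ne_none _ h).elim
    · exact (Option.some_ne_none _ h.symm).elim
    · exact congrArg Sum.inr (Subtype.ext rfl)
  · rintro (_ | e)
    · exact ⟨Sum.inr ⟨(), fun ⟨k, _⟩ => k.elim⟩, rfl⟩
    · exact ⟨Sum.inl ⟨e, hE e⟩, rfl⟩
  · rintro (e | e)
    · rfl
    · exact congrArg _ (comatchV_right growRule g hi hd ())
  · rintro (e | e)
    · rfl
    · exact congrArg _ (comatchV_new growRule g hi hd (1 : Fin 2) h1)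
  · exact fun _ => rfl
  · rintro (v | w)
    · exact (resultGraph_lab_of_forall_ne growRule g hi hd v fun k h => by cases h).symm
    · obtain ⟨w, hw'⟩ := w
      obtain rfl : w = (1 : Fin 2) := hw ⟨w, hw'⟩
      rfl
  · rintro (v | w)
    · exact (resultGraph_root_of_forall_ne growRule g hi hd v fun k h => by cases h).symm
    · obtain ⟨w, hw'⟩ := w
      obtain rfl : w = (1 : Fin 2) := hw ⟨w, hw'⟩
      rfl

/-! ### Steps of the tree recognition system -/

/-- `r2` applies to the edge `e`. -/
def CanPush (G : LGraph NodeLabel Blank) (e : G.E) : Prop :=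
  G.lab (G.src e) = some .square ∧ G.lab (G.tgt e) = some .square ∧
    G.root (G.src e) = some true ∧ G.root (G.tgt e) = some false

/-- `r0` or `r1` applies to the edge `e`. -/
def CanPrune (G : LGraph NodeLabel Blank) (e : G.E) : Prop :=
  G.lab (G.src e) ≠ none ∧ G.lab (G.tgt e) = some .square ∧
    G.root (G.src e) = some false ∧ G.root (G.tgt e) = some true ∧ IsPendant G e

theorem CanPrune.isPendant {G : LGraph NodeLabel Blank} {e : G.E} (h : CanPrune G e) :
    IsPendant G e := h.2.2.2.2

theorem CanPrune.src_ne_tgt {G : LGraph NodeLabel Blank} {e : G.E} (h : CanPrune G e) :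
    G.src e ≠ G.tgt e := fun h' => by simpa [h', h.2.2.2.1] using h.2.2.1

theorem step_iff {G M : LGraph NodeLabel Blank} :
    Step treeRules G M ↔
      (∃ e, CanPush G e ∧ Iso M (pushGraph G (G.src e) (G.tgt e))) ∨
      ∃ (e : G.E) (h : CanPrune G e), Iso M (pruneGraph G e h.isPendant) := by
  have prune_of : ∀ a (g : Hom (pruneRule a).L G) (hi : g.Injective)
      (hd : Dangling (pruneRule a) g), Iso M (resultGraph (pruneRule a) g hi hd) →
      ∃ (e : G.E) (h : CanPrune G e), Iso M (pruneGraph G e h.isPendant) := by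
    intro a g hi hd hM
    have hs : g.onV (0 : Fin 2) = G.src (g.onE ()) := g.src_comm ()
    have ht : g.onV (1 : Fin 2) = G.tgt (g.onE ()) := g.tgt_comm ()
    have hdel : DelV (pruneRule a) g (G.tgt (g.onE ())) := by
      refine ⟨(1 : Fin 2), ?_, ht⟩
      rintro ⟨k, hk⟩
      exact absurd (show (0 : Fin 2) = 1 from hk) (by decide)
    have hp : IsPendant G (g.onE ()) := by
      intro e' he'
      obtain ⟨h1, h2⟩ := hd e' fun ⟨_, h⟩ => he' h.symm
      exact ⟨fun h => h1 (h ▸ hdel), fun h => h2 (h ▸ hdel)⟩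
    refine ⟨g.onE (), ⟨?_, ?_, ?_, ?_, hp⟩, hM.trans (prune_iso a G g hi hd hp)⟩
    · rw [← hs, g.lab_comm (0 : Fin 2) a rfl]
      exact Option.some_ne_none _
    · rw [← ht, g.lab_comm (1 : Fin 2) .square rfl]
    · rw [← hs, g.root_comm (0 : Fin 2) false rfl]
    · rw [← ht, g.root_comm (1 : Fin 2) true rfl]
  constructor
  · rintro ⟨r, rfl | rfl | rfl, g, hi, hd, hM⟩
    · exact Or.inr (prune_of _ g hi hd hM)
    · exact Or.inr (prune_of _ g hi hd hM)
    · have hs : g.onV (0 : Fin 2) = G.src (g.onE ()) := g.src_comm ()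
      have ht : g.onV (1 : Fin 2) = G.tgt (g.onE ()) := g.tgt_comm ()
      have hM' := hM.trans (push_iso G g hi hd)
      rw [hs, ht] at hM'
      refine Or.inl ⟨g.onE (), ⟨?_, ?_, ?_, ?_⟩, hM'⟩
      · rw [← hs, g.lab_comm (0 : Fin 2) .square rfl]
      · rw [← ht, g.lab_comm (1 : Fin 2) .square rfl]
      · rw [← hs, g.root_comm (0 : Fin 2) true rfl]
      · rw [← ht, g.root_comm (1 : Fin 2) false rfl]
  · rintro (⟨e, ⟨h1, h2, h3, h4⟩, hM⟩ | ⟨e, ⟨h1, h2, h3, h4, hp⟩, hM⟩)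
    · have hi := edgeHom_injective e h1 h2 h3 h4 (by decide)
      have hd : Dangling r2 (edgeHom e h1 h2 h3 h4) := fun e' _ =>
        ⟨fun ⟨x, hx, _⟩ => hx ⟨x, rfl⟩, fun ⟨x, hx, _⟩ => hx ⟨x, rfl⟩⟩
      exact ⟨r2, Or.inr (Or.inr rfl), edgeHom e h1 h2 h3 h4, hi, hd,
        hM.trans (push_iso G _ hi hd).symm⟩
    · obtain ⟨a, ha⟩ := Option.ne_none_iff_exists'.1 h1
      have hi := edgeHom_injective e ha h2 h3 h4 (by decide)
      have hdel : ∀ v, DelV (pruneRule a) (edgeHom e ha h2 h3 h4) v → v = G.tgt e := by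
        rintro v ⟨x, hx, h⟩
        change Fin 2 at x
        fin_cases x
        · exact (hx ⟨(), rfl⟩).elim
        · exact h.symm
      have hd : Dangling (pruneRule a) (edgeHom e ha h2 h3 h4) := fun e' he' =>
        have hne : e' ≠ e := fun h => he' ⟨(), h.symm⟩
        ⟨fun h => (hp e' hne).1 (hdel _ h), fun h => (hp e' hne).2 (hdel _ h)⟩
      refine ⟨pruneRule a, ?_, edgeHom e ha h2 h3 h4, hi, hd,
        hM.trans (prune_iso a G _ hi hd hp).symm⟩
      cases a
      · exact Or.inl rfl
      · exact Or.inr (Or.inl rfl)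

theorem CanPush.step {G : LGraph NodeLabel Blank} {e : G.E} (h : CanPush G e) :
    Step treeRules G (pushGraph G (G.src e) (G.tgt e)) :=
  step_iff.2 (Or.inl ⟨e, h, Iso.refl _⟩)

theorem CanPrune.step {G : LGraph NodeLabel Blank} {e : G.E} (h : CanPrune G e) :
    Step treeRules G (pruneGraph G e h.isPendant) :=
  step_iff.2 (Or.inr ⟨e, h, Iso.refl _⟩)

theorem inNormalForm_iff {G : LGraph NodeLabel Blank} :
    InNormalForm treeRules G ↔ ∀ e, ¬ CanPush G e ∧ ¬ CanPrune G e := by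
  constructor
  · exact fun h e => ⟨fun h' => h ⟨_, h'.step⟩, fun h' => h ⟨_, h'.step⟩⟩
  · rintro h ⟨M, hM⟩
    rcases step_iff.1 hM with ⟨e, he, -⟩ | ⟨e, he, -⟩
    · exact (h e).1 he
    · exact (h e).2 he

theorem grow_step (T : LGraph Blank Blank) (p : T.V) (hl : T.lab p = some .square)
    (hr : T.root p = some false) : Step {growRule} T (growGraph T p) := by
  let g : Hom growRule.L T :=
    { onV := fun _ => p
      onE := fun e => e.elim
      src_comm := fun e => e.elim
      tgt_comm := fun e => e.elim
      edgeLab_comm := fun e => e.elim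
      lab_comm := fun _ _ h => hl.trans h
      root_comm := fun _ _ h => hr.trans h }
  have hi : g.Injective := ⟨fun _ _ _ => rfl, fun e => e.elim⟩
  have hd : Dangling growRule g := fun e _ =>
    ⟨fun ⟨x, hx, _⟩ => hx ⟨x, rfl⟩, fun ⟨x, hx, _⟩ => hx ⟨x, rfl⟩⟩
  exact ⟨growRule, rfl, g, hi, hd, (grow_iso T g hi hd).symm⟩

/-! ### Termination -/

/-- The number of nodes plus the number of nodes labelled with the square. Pushing turns a square
into a triangle, and pruning deletes a node, while at most one square appears for the one that is
deleted. -/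
noncomputable def weight (G : LGraph NodeLabel Blank) : ℕ :=
  Nat.card G.V + Nat.card {v : G.V // G.lab v = some .square}

theorem weight_congr {G H : LGraph NodeLabel Blank} (h : Iso G H) : weight G = weight H := by
  obtain ⟨φ, ψ, -, -, -, hl, -⟩ := iso_iff.1 h
  rw [weight, weight, Nat.card_congr φ,
    Nat.card_congr (φ.subtypeEquiv (q := fun v => H.lab v = some .square) fun v => by rw [hl])]

theorem weight_le (G : LGraph NodeLabel Blank) : weight G ≤ 2 * Nat.card G.V := by
  have := Finite.card_subtype_le fun v : G.V => G.lab v = some .square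
  rw [weight]
  omega

theorem card_subtype_lt_of_imp {α : Type} [Finite α] {p q : α → Prop} (h : ∀ v, p v → q v) (x : α)
    (hq : q x) (hp : ¬ p x) : Nat.card {v // p v} < Nat.card {v // q v} :=
  Set.ncard_lt_ncard (s := {v | p v}) (t := {v | q v})
    ⟨h, fun h' => hp (h' hq)⟩ (Set.toFinite _)

theorem CanPush.weight_lt {G : LGraph NodeLabel Blank} {e : G.E} (h : CanPush G e) :
    weight (pushGraph G (G.src e) (G.tgt e)) < weight G := by
  refine Nat.add_lt_add_left (card_subtype_lt_of_imp (α := G.V) (fun v hv => ?_) (G.src e) h.1 ?_) _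
  · by_cases hx : v = G.src e <;> simp_all [pushGraph]
  · simp [pushGraph]

theorem CanPrune.weight_lt {G : LGraph NodeLabel Blank} {e : G.E} (h : CanPrune G e) :
    weight (pruneGraph G e h.isPendant) < weight G := by
  classical
  refine Nat.add_lt_add_of_lt_of_le ?_ ?_
  · refine lt_of_lt_of_eq (card_subtype_lt_of_imp (α := G.V) (q := fun _ => True)
      (fun _ _ => trivial) (G.tgt e) trivial fun h => h rfl) ?_
    exact Nat.card_congr (Equiv.subtypeUnivEquiv fun _ => trivial)
  · -- The source may gain a square, so it is sent to the deleted target, which had one.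
    refine Nat.card_le_card_of_injective
      (fun v => if hv : v.1.1 = G.src e then ⟨G.tgt e, h.2.1⟩
        else ⟨v.1.1, (if_neg hv).symm.trans v.2⟩) ?_
    rintro ⟨⟨v, hv⟩, hvl⟩ ⟨⟨w, hw⟩, hwl⟩ hvw
    by_cases h1 : v = G.src e <;> by_cases h2 : w = G.src e
    · exact Subtype.ext (Subtype.ext (h1.trans h2.symm))
    · simp only [dif_pos h1, dif_neg h2, Subtype.mk.injEq] at hvw
      exact (hw hvw.symm).elim
    · simp only [dif_neg h1, dif_pos h2, Subtype.mk.injEq] at hvw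
      exact (hv hvw).elim
    · simp only [dif_neg h1, dif_neg h2, Subtype.mk.injEq] at hvw
      exact Subtype.ext (Subtype.ext hvw)

theorem Step.weight_lt {G M : LGraph NodeLabel Blank} (h : Step treeRules G M) :
    weight M < weight G := by
  rcases step_iff.1 h with ⟨e, he, hM⟩ | ⟨e, he, hM⟩
  · exact weight_congr hM ▸ he.weight_lt
  · exact weight_congr hM ▸ he.weight_lt

theorem add_weight_le_of_steps {k : ℕ} {D : ℕ → LGraph NodeLabel Blank}
    (h : ∀ i < k, Step treeRules (D i) (D (i + 1))) : k + weight (D k) ≤ weight (D 0) := by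
  induction k with
  | zero => simp
  | succ k ih =>
    have := ih fun i hi => h i (by omega)
    have := (h k (by omega)).weight_lt
    omega

theorem exists_normalForm (G : LGraph NodeLabel Blank) : ∃ H, IsNormalFormOf treeRules G H := by
  induction hn : weight G using Nat.strong_induction_on generalizing G with
  | _ n ih =>
    by_cases h : InNormalForm treeRules G
    · exact ⟨G, Or.inl (Iso.refl G), h⟩
    obtain ⟨M, hM⟩ := not_not.1 h
    obtain ⟨H, hH, hH'⟩ := ih _ (hn ▸ hM.weight_lt) M rfl
    by_cases h' : Relation.TransGen (Step treeRules) M H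
    · exact ⟨H, Or.inr (.head hM h'), hH'⟩
    · have hi : Iso M H := hH.resolve_right h'
      obtain ⟨r, hr, g, gi, gd, hg⟩ := hM
      exact ⟨H, Or.inr (.single ⟨r, hr, g, gi, gd, hi.symm.trans hg⟩), hH'⟩

/-! ### Trees -/

/-- Rooted trees with edges directed away from the root node of the tree: every node but one has
exactly one incoming edge, the exception has none, and some depth function increases along
edges. -/
def IsTree (T : LGraph LV LE) : Prop :=
  ∃ d : T.V → ℕ, (∀ e, d (T.src e) < d (T.tgt e)) ∧ Function.Injective T.tgt ∧
    ∃! v, ∀ e, T.tgt e ≠ v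

theorem IsTree.congr {T U : LGraph LV LE} (h : Iso T U) (hT : IsTree T) : IsTree U := by
  obtain ⟨φ, ψ, hs, ht, -⟩ := iso_iff.1 h
  obtain ⟨d, hd, hi, v, hv, huniq⟩ := hT
  have hs' : ∀ e, φ.symm (U.src e) = T.src (ψ.symm e) := fun e => by
    rw [Equiv.symm_apply_eq, hs]; simp
  have ht' : ∀ e, φ.symm (U.tgt e) = T.tgt (ψ.symm e) := fun e => by
    rw [Equiv.symm_apply_eq, ht]; simp
  refine ⟨d ∘ φ.symm, fun e => ?_, fun e e' he => ?_, φ v, fun e he => ?_, fun w hw => ?_⟩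
  · simp only [Function.comp, hs', ht', hd]
  · have := congrArg φ.symm he
    rw [ht', ht'] at this
    exact ψ.symm.injective (hi this)
  · rw [← Equiv.symm_apply_eq, ht'] at he
    exact hv _ he
  · rw [← Equiv.symm_apply_eq]
    refine huniq _ fun e he => hw (ψ e) ?_
    rw [← ht, he]; simp

theorem isTree_growGraph {T : LGraph Blank Blank} (hT : IsTree T) (p : T.V) :
    IsTree (growGraph T p) := by
  obtain ⟨d, hd, hi, v, hv, huniq⟩ := hT
  refine ⟨fun w => Option.elim w (d p + 1) d, ?_, Option.map_injective hi, some v, ?_, ?_⟩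
  · rintro (_ | e)
    · exact Nat.lt_succ_self _
    · exact hd e
  · rintro (_ | e) h
    · exact Option.some_ne_none _ h.symm
    · exact hv e (Option.some.inj h)
  · rintro (_ | w) hw
    · exact (hw none rfl).elim
    · exact congrArg some (huniq w fun e he => hw (some e) (congrArg some he))

theorem isTree_of_step {T U : LGraph Blank Blank} (h : Step {growRule} T U) (hT : IsTree T) :
    IsTree U := by
  obtain ⟨r, rfl, g, hi, hd, hU⟩ := h
  exact (isTree_growGraph hT _).congr (hU.trans (grow_iso T g hi hd)).symm

theorem isTree_of_mem_language {T : LGraph Blank Blank} (h : T ∈ treeGrammar.language) :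
    IsTree T := by
  have hstart : IsTree treeGrammar.start :=
    ⟨fun _ => 0, fun e => e.elim, fun e => e.elim, (), fun e => e.elim, fun _ _ => rfl⟩
  obtain ⟨h | h, -⟩ := h
  · exact hstart.congr h
  · induction h with
    | single h => exact isTree_of_step h hstart
    | tail _ h ih => exact isTree_of_step h ih

theorem mem_language_iff {T : LGraph Blank Blank} :
    T ∈ treeGrammar.language ↔ Derives {growRule} (oneNode (some .square) (some false)) T :=
  ⟨fun h => h.1, fun h => ⟨h, fun _ _ _ h => h, fun _ h => h⟩⟩

theorem mem_language_congr {T U : LGraph Blank Blank} (h : Iso T U)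
    (hT : T ∈ treeGrammar.language) : U ∈ treeGrammar.language := by
  rw [mem_language_iff] at hT ⊢
  rcases hT with hT | hT
  · exact Or.inl (hT.trans h)
  · obtain ⟨X, hX, r, hr, g, hi, hd, hg⟩ := Relation.TransGen.tail'_iff.1 hT
    exact Or.inr (Relation.TransGen.tail'_iff.2 ⟨X, hX, r, hr, g, hi, hd, h.symm.trans hg⟩)

theorem iso_growGraph {T U : LGraph Blank Blank} (h : Iso T U) (p : T.V) :
    ∃ q : U.V, U.lab q = T.lab p ∧ U.root q = T.root p ∧
      Iso (growGraph T p) (growGraph U q) := by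
  obtain ⟨φ, ψ, hs, ht, he, hl, hr⟩ := iso_iff.1 h
  refine ⟨φ p, hl p, hr p, iso_iff.2 ⟨φ.optionCongr, ψ.optionCongr, ?_, ?_, ?_, ?_, ?_⟩⟩
  · rintro (_ | e)
    · rfl
    · exact congrArg some (hs e)
  · rintro (_ | e)
    · rfl
    · exact congrArg some (ht e)
  · exact fun _ => rfl
  · rintro (_ | v)
    · rfl
    · exact hl v
  · rintro (_ | v)
    · rfl
    · exact hr v

theorem growGraph_mem_language {T : LGraph Blank Blank} (hT : T ∈ treeGrammar.language) (p : T.V)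
    (hl : T.lab p = some .square) (hr : T.root p = some false) :
    growGraph T p ∈ treeGrammar.language := by
  rw [mem_language_iff] at hT ⊢
  rcases hT with hT | hT
  · obtain ⟨q, hl', hr', h⟩ := iso_growGraph hT.symm p
    obtain ⟨r, hr, g, hi, hd, hg⟩ := grow_step _ q (hl'.trans hl) (hr'.trans hr)
    exact Or.inr (.single ⟨r, hr, g, hi, hd, h.trans hg⟩)
  · exact Or.inr (hT.tail (grow_step T p hl hr))

/-! ### Steps and trees -/

theorem iso_strip {G H : LGraph NodeLabel Blank} (h : Iso G H) : Iso (strip G) (strip H) := by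
  obtain ⟨φ, ψ, hs, ht, -⟩ := iso_iff.1 h
  exact iso_iff.2 ⟨φ, ψ, hs, ht, fun _ => rfl, fun _ => rfl, fun _ => rfl⟩

/-- Pruning undoes the attachment of a leaf. -/
theorem strip_iso_growGraph {G : LGraph NodeLabel Blank} {e : G.E} (hp : IsPendant G e)
    (hne : G.src e ≠ G.tgt e) :
    Iso (growGraph (strip (pruneGraph G e hp)) ⟨G.src e, hne⟩) (strip G) := by
  classical
  refine Iso.of_bijective (fun v => Option.elim v (G.tgt e) Subtype.val)
    (fun e' => Option.elim e' e Subtype.val) ⟨?_, ?_⟩ ⟨?_, ?_⟩ ?_ ?_ ?_ ?_ ?_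
  · rintro (_ | v) (_ | w) h
    · rfl
    · exact (w.2 h.symm).elim
    · exact (v.2 h).elim
    · exact congrArg some (Subtype.ext h)
  · intro v
    by_cases h : v = G.tgt e
    · exact ⟨none, h.symm⟩
    · exact ⟨some ⟨v, h⟩, rfl⟩
  · rintro (_ | v) (_ | w) h
    · rfl
    · exact (w.2 h.symm).elim
    · exact (v.2 h).elim
    · exact congrArg some (Subtype.ext h)
  · intro v
    by_cases h : v = e
    · exact ⟨none, h.symm⟩
    · exact ⟨some ⟨v, h⟩, rfl⟩
  · rintro (_ | e') <;> rfl
  · rintro (_ | e') <;> rfl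
  · exact fun _ => rfl
  · rintro (_ | v) <;> rfl
  · rintro (_ | v) <;> rfl

/-- Reversing a step does not lead out of the language of trees: reversing a push does not change
the unlabelled graph, and reversing a pruning attaches a leaf. -/
theorem strip_mem_language_of_step {G M : LGraph NodeLabel Blank} (h : Step treeRules G M)
    (hM : strip M ∈ treeGrammar.language) : strip G ∈ treeGrammar.language := by
  rcases step_iff.1 h with ⟨e, he, hi⟩ | ⟨e, he, hi⟩
  · have hs := iso_strip hi
    exact mem_language_congr hs hM
  · exact mem_language_congr (strip_iso_growGraph he.isPendant he.src_ne_tgt)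
      (growGraph_mem_language (mem_language_congr (iso_strip hi) hM) _ rfl rfl)

theorem strip_mem_language_of_derives {G H : LGraph NodeLabel Blank} (h : Derives treeRules G H)
    (hH : strip H ∈ treeGrammar.language) : strip G ∈ treeGrammar.language := by
  rcases h with h | h
  · exact mem_language_congr (iso_strip h.symm) hH
  · induction h with
    | single h => exact strip_mem_language_of_step h hH
    | tail _ h ih => exact ih (strip_mem_language_of_step h hH)

theorem strip_mem_language_of_iso_singleRoot {H : LGraph NodeLabel Blank} (h : Iso H singleRoot) :
    strip H ∈ treeGrammar.language := by
  refine mem_language_iff.2 (Or.inl ((iso_strip h).trans ?_).symm)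
  exact iso_iff.2 ⟨Equiv.refl Unit, Equiv.refl Empty, fun e => e.elim, fun e => e.elim,
    fun e => e.elim, fun _ => rfl, fun _ => rfl⟩

/-- Totally labelled and totally rooted, with a single root node, which is labelled with the
square. -/
def IsSingleRooted (G : LGraph NodeLabel Blank) : Prop :=
  G.IsTLRG ∧ ∃ x, G.lab x = some .square ∧ ∀ v, G.root v = some true ↔ v = x

theorem IsInputGraph.isSingleRooted {G : LGraph NodeLabel Blank} (h : IsInputGraph G) :
    IsSingleRooted G := by
  obtain ⟨ht, hl, x, hx, hu⟩ := h
  exact ⟨ht, x, hl x, fun v => ⟨hu v, fun h => h ▸ hx⟩⟩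

theorem IsSingleRooted.congr {G H : LGraph NodeLabel Blank} (h : Iso G H)
    (hG : IsSingleRooted G) : IsSingleRooted H := by
  obtain ⟨φ, ψ, -, -, -, hl, hr⟩ := iso_iff.1 h
  obtain ⟨⟨h1, h2⟩, x, hx, hu⟩ := hG
  refine ⟨⟨φ.forall_congr_right.1 fun v => ?_, φ.forall_congr_right.1 fun v => ?_⟩, φ x, ?_,
    φ.forall_congr_right.1 fun v => ?_⟩
  · rw [hl]; exact h1 v
  · rw [hr]; exact h2 v
  · rw [hl]; exact hx
  · rw [hr, hu, φ.injective.eq_iff]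

theorem CanPush.isSingleRooted {G : LGraph NodeLabel Blank} {e : G.E} (h : CanPush G e)
    (hG : IsSingleRooted G) : IsSingleRooted (pushGraph G (G.src e) (G.tgt e)) := by
  obtain ⟨⟨h1, h2⟩, x, hx, hu⟩ := hG
  obtain ⟨-, hl, hr, hr'⟩ := h
  have hne : G.tgt e ≠ G.src e := fun h => by simp [← h, hr'] at hr
  refine ⟨⟨fun v => ?_, fun v => ?_⟩, G.tgt e, (if_neg hne).trans hl, fun v => ?_⟩
  · simp only [pushGraph]
    split_ifs
    · simp
    · exact h1 v
  · simp only [pushGraph]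
    split_ifs
    · simp
    · simp
    · exact h2 v
  · rw [hu] at hr
    simp only [pushGraph]
    split_ifs with ha hb
    · simpa using fun h => hne (h.symm.trans ha)
    · simpa using hb
    · exact ⟨fun h => (ha (((hu v).1 h).trans hr.symm)).elim, fun h => (hb h).elim⟩

theorem CanPrune.isSingleRooted {G : LGraph NodeLabel Blank} {e : G.E} (h : CanPrune G e)
    (hG : IsSingleRooted G) : IsSingleRooted (pruneGraph G e h.isPendant) := by
  obtain ⟨⟨h1, h2⟩, x, hx, hu⟩ := hG
  have hr := h.2.2.2.1
  rw [hu] at hr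
  refine ⟨⟨fun v => ?_, fun v => ?_⟩, ⟨G.src e, h.src_ne_tgt⟩, if_pos rfl, fun v => ?_⟩
  · simp only [pruneGraph]
    split_ifs
    · simp
    · exact h1 _
  · simp only [pruneGraph]
    split_ifs
    · simp
    · exact h2 _
  · have hv := v.2
    refine Iff.trans ?_ Subtype.ext_iff.symm
    simp only [pruneGraph]
    split_ifs with ha
    · simpa using ha
    · exact ⟨fun h => (hv (((hu _).1 h).trans hr.symm)).elim, fun h => (ha h).elim⟩

/-- The triangles of the graph lie on a path that leads downwards to the root node: every node
labelled with the triangle has a child which is again such a node, or the root node. -/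
def TrianglesLead (G : LGraph NodeLabel Blank) : Prop :=
  ∀ v, G.lab v = some .triangle →
    ∃ e, G.src e = v ∧ (G.lab (G.tgt e) = some .triangle ∨ G.root (G.tgt e) = some true)

theorem TrianglesLead.congr {G H : LGraph NodeLabel Blank} (h : Iso G H)
    (hG : TrianglesLead G) : TrianglesLead H := by
  obtain ⟨φ, ψ, hs, ht, -, hl, hr⟩ := iso_iff.1 h
  refine φ.forall_congr_right.1 fun v hv => ?_
  obtain ⟨e, rfl, he⟩ := hG v (by rwa [hl] at hv)
  refine ⟨ψ e, (hs e).symm, ?_⟩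
  rwa [← ht, hl, hr]

theorem CanPush.trianglesLead {G : LGraph NodeLabel Blank} {e : G.E} (h : CanPush G e)
    (hG : IsSingleRooted G) (hT : TrianglesLead G) :
    TrianglesLead (pushGraph G (G.src e) (G.tgt e)) := by
  obtain ⟨-, x, -, hu⟩ := hG
  obtain ⟨hl, hl', hr, hr'⟩ := h
  have hne : G.tgt e ≠ G.src e := fun h => by simp [← h, hr'] at hr
  intro v hv
  simp only [pushGraph] at hv ⊢
  by_cases hvs : v = G.src e
  · exact ⟨e, hvs.symm, Or.inr (by simp [hne])⟩
  · obtain ⟨e', he', h⟩ := hT v ((if_neg hvs).symm.trans hv)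
    refine ⟨e', he', Or.inl ?_⟩
    split_ifs with ha
    · rfl
    · refine h.resolve_right fun h' => ha ?_
      rw [hu] at hr h'
      exact h'.trans hr.symm

theorem CanPrune.trianglesLead {G : LGraph NodeLabel Blank} {e : G.E} (h : CanPrune G e)
    (hT : TrianglesLead G) :
    TrianglesLead (pruneGraph G e h.isPendant) := by
  rintro ⟨v, hvt⟩ hv
  by_cases hvs : v = G.src e
  · simp [pruneGraph, hvs] at hv
  · obtain ⟨e', rfl, h'⟩ := hT v ((if_neg hvs).symm.trans hv)
    -- The child survives, because the only parent of the deleted node is no triangle any more.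
    have he' : e' ≠ e := fun h => hvs (h ▸ rfl)
    refine ⟨⟨e', he'⟩, rfl, ?_⟩
    simp only [pruneGraph]
    split_ifs with ha
    · exact Or.inr rfl
    · exact h'

theorem CanPrune.isTree {G : LGraph NodeLabel Blank} {e : G.E} (h : CanPrune G e)
    (hT : IsTree G) : IsTree (pruneGraph G e h.isPendant) := by
  obtain ⟨d, hd, hi, v, hv, hu⟩ := hT
  refine ⟨fun v => d v.1, fun e' => hd e'.1, fun e₁ e₂ h => ?_, ⟨v, (hv e).symm⟩,
    fun e' he' => hv e'.1 (congrArg Subtype.val he'), fun w hw => ?_⟩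
  · exact Subtype.ext (hi (Subtype.mk.inj h))
  · refine Subtype.ext (hu w.1 fun e' he' => ?_)
    have hne : e' ≠ e := fun h => w.2 (h ▸ he'.symm)
    exact hw ⟨e', hne⟩ (Subtype.ext he')

/-- The invariant of a run on a tree. -/
def IsTreeState (G : LGraph NodeLabel Blank) : Prop :=
  IsTree G ∧ IsSingleRooted G ∧ TrianglesLead G

theorem IsTreeState.congr {G H : LGraph NodeLabel Blank} (h : Iso G H) (hG : IsTreeState G) :
    IsTreeState H :=
  ⟨hG.1.congr h, hG.2.1.congr h, hG.2.2.congr h⟩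

theorem IsTreeState.of_step {G M : LGraph NodeLabel Blank} (h : Step treeRules G M)
    (hG : IsTreeState G) : IsTreeState M := by
  obtain ⟨h1, h2, h3⟩ := hG
  rcases step_iff.1 h with ⟨e, he, hi⟩ | ⟨e, he, hi⟩
  · exact IsTreeState.congr hi.symm ⟨h1, he.isSingleRooted h2, he.trianglesLead h2 h3⟩
  · exact IsTreeState.congr hi.symm ⟨he.isTree h1, he.isSingleRooted h2, he.trianglesLead h3⟩

theorem IsTreeState.of_derives {G H : LGraph NodeLabel Blank} (h : Derives treeRules G H)
    (hG : IsTreeState G) : IsTreeState H := by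
  rcases h with h | h
  · exact hG.congr h
  · induction h with
    | single h => exact hG.of_step h
    | tail _ h ih => exact ih.of_step h

/-- In a tree without applicable rule the root node has no children, because a child would be a
square, to which the root could be pushed, or a triangle, which is above the root node. Then it has
no parent either, because it could be pruned. -/
theorem IsTreeState.iso_singleRoot {H : LGraph NodeLabel Blank} (hH : IsTreeState H)
    (hn : InNormalForm treeRules H) : Iso H singleRoot := by
  obtain ⟨⟨d, hd, hinj, v₀, hv₀, huniq⟩, ⟨⟨hl, hr⟩, x, hx, hroot⟩, hT⟩ := hH
  rw [inNormalForm_iff] at hn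
  have hroot' : ∀ v, v ≠ x → H.root v = some false := by
    intro v hv
    obtain ⟨b, hb⟩ := Option.ne_none_iff_exists'.1 (hr v)
    cases b
    · exact hb
    · exact (hv ((hroot v).1 hb)).elim
  -- A deepest triangle has a child that is no triangle, hence the root node.
  have htri : ∀ v, H.lab v = some .triangle → d v < d x := by
    intro v hv
    obtain ⟨m, hm, hmax⟩ := Set.exists_max_image {v | H.lab v = some .triangle} d
      (Set.toFinite _) ⟨v, hv⟩
    obtain ⟨e, rfl, he | he⟩ := hT m hm
    · exact absurd (hmax _ he) (hd e).not_ge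
    · rw [hroot] at he
      exact (hmax v hv).trans_lt (he ▸ hd e)
  have hout : ∀ e, H.src e ≠ x := by
    rintro e he
    have hlt := hd e
    have hte : H.tgt e ≠ x := fun h => by rw [he, h] at hlt; exact hlt.false
    refine (hn e).1 ⟨he ▸ hx, ?_, (hroot _).2 he, hroot' _ hte⟩
    obtain ⟨a, ha⟩ := Option.ne_none_iff_exists'.1 (hl (H.tgt e))
    cases a
    · exact ha
    · rw [he] at hlt
      exact absurd (htri _ ha) hlt.not_gt
  have hin : ∀ e, H.tgt e ≠ x := by
    intro e he
    refine (hn e).2 ⟨hl _, he ▸ hx, hroot' _ (hout e), (hroot _).2 he, fun e' hne => ⟨?_, ?_⟩⟩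
    · exact he ▸ hout e'
    · exact fun h => hne (hinj h)
  -- A node of least depth other than `x` has no parent, but only `x` has none.
  have hall : ∀ v, v = x := by
    by_contra! hex
    obtain ⟨m, hm, hmin⟩ := Set.exists_min_image {v | v ≠ x} d (Set.toFinite _) hex
    have : ∃ e, H.tgt e = m := by
      by_contra! h
      exact hm ((huniq m h).trans (huniq x hin).symm)
    obtain ⟨e, rfl⟩ := this
    exact absurd (hmin _ (hout e)) (hd e).not_ge
  refine Iso.of_bijective (fun _ => ()) (fun e => (hout e (hall _)).elim)
    ⟨fun v w _ => (hall v).trans (hall w).symm, fun _ => ⟨x, rfl⟩⟩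
    ⟨fun e => (hout e (hall _)).elim, fun e => e.elim⟩ (fun e => (hout e (hall _)).elim)
    (fun e => (hout e (hall _)).elim) (fun e => (hout e (hall _)).elim) ?_ ?_
  · exact fun v => by rw [hall v, hx]; rfl
  · exact fun v => by rw [hall v, (hroot x).2 rfl]; rfl

theorem IsInputGraph.isTreeState {G : LGraph NodeLabel Blank} (h : IsInputGraph G)
    (hT : strip G ∈ treeGrammar.language) : IsTreeState G := by
  refine ⟨isTree_of_mem_language hT, h.isSingleRooted, fun v hv => ?_⟩
  simp [h.2.1 v] at hv

/-- Normal forms decide the language of trees. -/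
theorem iso_singleRoot_iff {G H : LGraph NodeLabel Blank} (hG : IsInputGraph G)
    (hH : IsNormalFormOf treeRules G H) :
    Iso H singleRoot ↔ strip G ∈ treeGrammar.language :=
  ⟨fun h => strip_mem_language_of_derives hH.1 (strip_mem_language_of_iso_singleRoot h),
    fun h => ((hG.isTreeState h).of_derives hH.1).iso_singleRoot hH.2⟩

/-! ### Runs of programs -/

section Run

variable [DecidableEq LV] [DecidableEq LE]

/-- The configuration of `P` after `t` executed instructions, started in `c`. -/
def Program.run (P : Program LV LE) (c : Config LV LE) : ℕ → Option (Config LV LE)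
  | 0 => some c
  | t + 1 => (Program.run P c t).bind fun c => (P[c.pc]?).bind (exec c)

theorem Program.after_eq_run (P : Program LV LE) (S : Store LV LE) (t : ℕ) :
    P.after S t = P.run (Config.init S) t := by
  induction t with
  | zero => rfl
  | succ t ih => rw [Program.after, Program.run, ih]

theorem Program.run_add {P : Program LV LE} {c c' : Config LV LE} {m : ℕ}
    (h : P.run c m = some c') (n : ℕ) : P.run c (m + n) = P.run c' n := by
  induction n with
  | zero => exact h
  | succ n ih => rw [← Nat.add_assoc, Program.run, Program.run, ih]

end Run

/-! ### The program -/

/-- The tree recognition program. Instructions 0 to 8 look for an edge from the root node to an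
unrooted node labelled with the square, 9 to 12 push the root node along it, 13 to 16 check that the
root node, which has no outgoing edges, has exactly one incoming edge, and 18 to 23 prune it.
Register 0 for nodes holds the root node. -/
def treeProgram : Program NodeLabel Blank :=
  [.firstRoot 0, .firstOut 0 0, .jumpNoEdge 0 13,
    .target 1 0, .jumpRoot 1 6, .jumpLabel 1 .square 9, .nextOut 0 0, .jumpNoEdge 0 17, .jump 3,
    .setLabel 0 .triangle, .setRoot 0 false, .setRoot 1 true, .jump 0,
    .firstIn 0 0, .jumpNoEdge 0 17, .nextIn 1 0, .jumpNoEdge 1 18, .halt,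
    .source 1 0, .delEdge 0, .delNode 0, .setLabel 1 .square, .setRoot 1 true, .jump 0]

section Segments

variable {nr er : ℕ → Option ℕ} {S : Store NodeLabel Blank} {a b : ℕ} {n m : NodeRec NodeLabel}
  {d : EdgeRec Blank}

theorem run_start (hr : S.roots = [a]) (ha : S.node a = some n) :
    treeProgram.run ⟨0, nr, er, S⟩ 3 =
      some ⟨if S.outAdj a = [] then 13 else 3, Function.update nr 0 (some a),
        Function.update er 0 (S.outAdj a).head?, S⟩ := by
  by_cases h : S.outAdj a = [] <;>
  simp [Program.run, treeProgram, exec, Config.setN, Config.setE, Config.next, Config.goto,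
    Config.nodeAt, hr, ha, h]

/-- The loop passes over an edge to the root node or to a triangle, and goes on with the next
outgoing edge or halts. -/
theorem run_skip (ha : nr 0 = some a) (hb : er 0 = some b) (hd : S.edge b = some d)
    (hm : S.node d.tgt = some m) (hs : m.isRoot = true ∨ m.lab = .triangle) :
    ∃ k ≤ 6, ∃ nr', nr' 0 = some a ∧ treeProgram.run ⟨3, nr, er, S⟩ k =
      some ⟨if succIn (S.outAdj d.src) b = none then 17 else 3, nr',
        Function.update er 0 (succIn (S.outAdj d.src) b), S⟩ := by
  refine ⟨(if m.isRoot then 0 else 1) + if succIn (S.outAdj d.src) b = none then 4 else 5, ?_,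
    Function.update nr 1 (some d.tgt), by simpa using ha, ?_⟩
  · split_ifs <;> omega
  · by_cases h1 : m.isRoot = true
    · by_cases h2 : succIn (S.outAdj d.src) b = none <;>
      simp [Program.run, treeProgram, exec, Config.setN, Config.setE, Config.next, Config.goto,
        Config.nodeAt, Config.edgeAt, hb, hd, hm, h1, h2]
    · have h3 := hs.resolve_left h1
      by_cases h2 : succIn (S.outAdj d.src) b = none <;>
      simp [Program.run, treeProgram, exec, Config.setN, Config.setE, Config.next, Config.goto,
        Config.nodeAt, Config.edgeAt, hb, hd, hm, h1, h2, h3]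

theorem run_push (ha : nr 0 = some a) (hb : er 0 = some b) (hd : S.edge b = some d)
    (hn : S.node a = some n) (hm : S.node d.tgt = some m) (hs : m.isRoot = false)
    (hl : m.lab = .square) (hne : d.tgt ≠ a) :
    treeProgram.run ⟨3, nr, er, S⟩ 7 = some ⟨0, Function.update nr 1 (some d.tgt), er,
      ((S.setLabel a n .triangle).setRoot a ⟨.triangle, n.isRoot⟩ false).setRoot d.tgt m true⟩ := by
  simp [Program.run, treeProgram, exec, Config.setN, Config.setS, Config.next, Config.goto,
      Config.nodeAt, Config.edgeAt, ha, hb, hd, hn, hm, hs, hl, hne, Store.setLabel,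
      Store.setRoot]

/-- An isolated root node is left alone. -/
theorem run_noIn (ha : nr 0 = some a) (hn : S.node a = some n) (h : S.inAdj a = []) :
    treeProgram.run ⟨13, nr, er, S⟩ 2 = some ⟨17, nr, Function.update er 0 none, S⟩ := by
  simp [Program.run, treeProgram, exec, Config.setE, Config.next, Config.goto,
    Config.nodeAt, ha, hn, h]

/-- A root node with several incoming edges violates the dangling condition and is left alone. -/
theorem run_twoIn (ha : nr 0 = some a) (hn : S.node a = some n) {b' : ℕ} {l : List ℕ}
    (h : S.inAdj a = b :: b' :: l) (hd : S.edge b = some d) (ht : d.tgt = a) :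
    treeProgram.run ⟨13, nr, er, S⟩ 4 = some ⟨17, nr,
      Function.update (Function.update er 0 (some b)) 1 (some b'), S⟩ := by
  simp [Program.run, treeProgram, exec, Config.setE, Config.next, Config.goto,
    Config.nodeAt, Config.edgeAt, ha, hn, h, hd, ht, succIn]

theorem run_prune (ha : nr 0 = some a) (hn : S.node a = some n) (h : S.inAdj a = [b])
    (hd : S.edge b = some d) (ht : d.tgt = a) (hm : S.node d.src = some m) (hne : d.src ≠ a) :
    treeProgram.run ⟨13, nr, er, S⟩ 10 = some ⟨0, Function.update nr 1 (some d.src),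
      Function.update (Function.update er 0 (some b)) 1 none,
      (((S.delEdge b d).delNode a).setLabel d.src m .square).setRoot d.src ⟨.square, m.isRoot⟩
        true⟩ := by
  simp [Program.run, treeProgram, exec, Config.setE, Config.setN, Config.setS, Config.next,
    Config.goto, Config.nodeAt, Config.edgeAt, ha, hn, h, hd, ht, succIn, hm, hne,
    Store.setLabel, Store.setRoot, Store.delEdge, Store.delNode]

end Segments

theorem succIn_append {l₁ l₂ : List ℕ} {b : ℕ} (h : b ∉ l₁) :
    succIn (l₁ ++ b :: l₂) b = l₂.head? := by
  induction l₁ with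
  | nil => simp [succIn]
  | cons c l₁ ih =>
    rw [List.mem_cons, not_or] at h
    rw [List.cons_append, succIn, if_neg (Ne.symm h.1), ih h.2]

/-! ### Stores holding a graph -/

/-- The store `S` holds the graph `G`, with its nodes at the addresses `ν` and its edges at the
addresses `ε`. -/
structure Store.Holds (S : Store LV LE) (G : LGraph LV LE) (ν : G.V → ℕ) (ε : G.E → ℕ) :
    Prop where
  node_inj : Function.Injective ν
  edge_inj : Function.Injective ε
  node_ne_none : ∀ a, S.node a ≠ none ↔ ∃ v, ν v = a
  edge_ne_none : ∀ a, S.edge a ≠ none ↔ ∃ e, ε e = a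
  node_eq : ∀ v, ∃ x b, G.lab v = some x ∧ G.root v = some b ∧ S.node (ν v) = some ⟨x, b⟩
  edge_eq : ∀ e, S.edge (ε e) = some ⟨ν (G.src e), ν (G.tgt e), G.edgeLab e⟩
  out_eq : ∀ v, (S.outAdj (ν v)).Nodup ∧ ∀ a, a ∈ S.outAdj (ν v) ↔ ∃ e, ε e = a ∧ G.src e = v
  in_eq : ∀ v, (S.inAdj (ν v)).Nodup ∧ ∀ a, a ∈ S.inAdj (ν v) ↔ ∃ e, ε e = a ∧ G.tgt e = v
  roots_nodup : S.roots.Nodup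
  mem_roots : ∀ a, a ∈ S.roots ↔ ∃ v, ν v = a ∧ G.root v = some true

theorem Store.represents_iff {S : Store LV LE} {G : LGraph LV LE} :
    S.Represents G ↔ ∃ ν ε, S.Holds G ν ε :=
  ⟨fun ⟨ν, ε, h1, h2, h3, h4, h5, h6, h7, h8, h9, h10⟩ =>
    ⟨ν, ε, h1, h2, h3, h4, h5, h6, h7, h8, h9, h10⟩,
    fun ⟨ν, ε, h1, h2, h3, h4, h5, h6, h7, h8, h9, h10⟩ =>
    ⟨ν, ε, h1, h2, h3, h4, h5, h6, h7, h8, h9, h10⟩⟩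

theorem Store.Holds.node_eq_of {S : Store LV LE} {G : LGraph LV LE} {ν : G.V → ℕ} {ε : G.E → ℕ}
    (h : S.Holds G ν ε) {v : G.V} {x : LV} {b : Bool} (hx : G.lab v = some x)
    (hb : G.root v = some b) : S.node (ν v) = some ⟨x, b⟩ := by
  obtain ⟨x', b', hx', hb', h'⟩ := h.node_eq v
  rw [h', Option.some.inj (hx.symm.trans hx'), Option.some.inj (hb.symm.trans hb')]

theorem Store.Holds.length_outAdj_le {S : Store LV LE} {G : LGraph LV LE} {ν : G.V → ℕ}
    {ε : G.E → ℕ} (h : S.Holds G ν ε) (v : G.V) : (S.outAdj (ν v)).length ≤ G.deg v := by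
  obtain ⟨hn, hm⟩ := h.out_eq v
  have h1 : ((S.outAdj (ν v)).toFinset : Set ℕ) = ε '' {e | G.src e = v} := by
    ext a
    simp [hm, and_comm]
  rw [← List.toFinset_card_of_nodup hn, ← Set.ncard_coe_finset, h1,
    Set.ncard_image_of_injective _ h.edge_inj]
  exact Nat.le_add_left _ _

/-- The store after `run_push` holds the pushed graph. -/
theorem CanPush.holds {G : LGraph NodeLabel Blank} {e : G.E} (h : CanPush G e)
    (hG : IsSingleRooted G) {S : Store NodeLabel Blank} {ν : G.V → ℕ} {ε : G.E → ℕ}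
    (hS : S.Holds G ν ε) :
    (((S.setLabel (ν (G.src e)) ⟨.square, true⟩ .triangle).setRoot (ν (G.src e))
      ⟨.triangle, true⟩ false).setRoot (ν (G.tgt e)) ⟨.square, false⟩ true).Holds
      (pushGraph G (G.src e) (G.tgt e)) ν ε := by
  obtain ⟨-, x, hx, hu⟩ := hG
  obtain ⟨hl, hl', hr, hr'⟩ := h
  have hne : G.tgt e ≠ G.src e := fun h => by simp [← h, hr'] at hr
  have hsx : G.src e = x := (hu _).1 hr
  refine ⟨hS.node_inj, hS.edge_inj, fun a => ?_, hS.edge_ne_none, fun v => ?_, hS.edge_eq,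
    hS.out_eq, hS.in_eq, ?_, fun a => ?_⟩
  · simp only [Store.setRoot, Store.setLabel]
    by_cases h1 : a = ν (G.tgt e)
    · subst h1
      simp only [Function.update_self]
      exact iff_of_true (Option.some_ne_none _) ⟨_, rfl⟩
    rw [Function.update_of_ne h1]
    by_cases h2 : a = ν (G.src e)
    · subst h2
      simp only [Function.update_self]
      exact iff_of_true (Option.some_ne_none _) ⟨_, rfl⟩
    rw [Function.update_of_ne h2, Function.update_of_ne h2]
    exact hS.node_ne_none a
  · simp only [Store.setRoot, Store.setLabel, pushGraph]
    by_cases h2 : v = G.src e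
    · subst h2
      have : ν (G.src e) ≠ ν (G.tgt e) := fun h => hne (hS.node_inj h).symm
      exact ⟨.triangle, false, if_pos rfl, if_pos rfl, by simp [Function.update_of_ne this]⟩
    by_cases h1 : v = G.tgt e
    · subst h1
      exact ⟨.square, true, (if_neg h2).trans hl', (if_neg h2).trans (if_pos rfl), by simp⟩
    obtain ⟨y, b, hy, hb, hyb⟩ := hS.node_eq v
    exact ⟨y, b, (if_neg h2).trans hy, (if_neg h2).trans ((if_neg h1).trans hb), by
      rw [Function.update_of_ne (hS.node_inj.ne h1), Function.update_of_ne (hS.node_inj.ne h2),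
        Function.update_of_ne (hS.node_inj.ne h2), hyb]⟩
  · simp only [Store.setRoot, Store.setLabel, if_true, Bool.false_eq_true, if_false]
    refine List.nodup_cons.2 ⟨fun h => ?_, hS.roots_nodup.erase _⟩
    obtain ⟨v, hv, hv'⟩ := (hS.mem_roots _).1 (List.mem_of_mem_erase h)
    rw [hS.node_inj hv, hr'] at hv'
    cases hv'
  · simp only [Store.setRoot, Store.setLabel, if_true, Bool.false_eq_true, if_false,
      List.mem_cons, hS.roots_nodup.mem_erase_iff, hS.mem_roots, pushGraph]
    constructor
    · rintro (rfl | ⟨h1, v, rfl, hv⟩)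
      · exact ⟨G.tgt e, rfl, by rw [if_neg hne, if_pos rfl]⟩
      · exact (h1 (congrArg ν (((hu v).1 hv).trans hsx.symm))).elim
    · rintro ⟨v, rfl, hv⟩
      split_ifs at hv with h1 h2
      · cases hv
      · exact Or.inl (congrArg ν h2)
      · exact (h1 (((hu v).1 hv).trans hsx.symm)).elim

/-- The store after `run_prune` holds the pruned graph. -/
theorem CanPrune.holds {G : LGraph NodeLabel Blank} {e : G.E} (h : CanPrune G e)
    (hG : IsSingleRooted G) {S : Store NodeLabel Blank} {ν : G.V → ℕ} {ε : G.E → ℕ}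
    (hS : S.Holds G ν ε) {l : NodeLabel} :
    ((((S.delEdge (ε e) ⟨ν (G.src e), ν (G.tgt e), G.edgeLab e⟩).delNode (ν (G.tgt e))).setLabel
      (ν (G.src e)) ⟨l, false⟩ .square).setRoot (ν (G.src e)) ⟨.square, false⟩ true).Holds
      (pruneGraph G e h.isPendant) (fun v => ν v.1) fun e' => ε e'.1 := by
  obtain ⟨-, x, hx, hu⟩ := hG
  have hne := h.src_ne_tgt
  obtain ⟨hl, hl', hr, hr', hp⟩ := h
  have htx : G.tgt e = x := (hu _).1 hr'
  refine ⟨fun v w h => Subtype.ext (hS.node_inj h), fun v w h => Subtype.ext (hS.edge_inj h),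
    fun a => ?_, fun a => ?_, fun v => ?_, fun e' => ?_, fun v => ?_, fun v => ?_, ?_, fun a => ?_⟩
  · simp only [Store.setRoot, Store.setLabel, Store.delNode, Store.delEdge]
    by_cases h1 : a = ν (G.src e)
    · subst h1
      rw [Function.update_self]
      exact iff_of_true (Option.some_ne_none _) ⟨⟨G.src e, hne⟩, rfl⟩
    rw [Function.update_of_ne h1, Function.update_of_ne h1]
    by_cases h2 : a = ν (G.tgt e)
    · subst h2
      rw [Function.update_self]
      exact iff_of_false (fun h => h rfl) fun ⟨v, hv⟩ => v.2 (hS.node_inj hv)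
    rw [Function.update_of_ne h2, hS.node_ne_none]
    constructor
    · rintro ⟨v, rfl⟩
      exact ⟨⟨v, fun h => h2 (congrArg ν h)⟩, rfl⟩
    · rintro ⟨v, rfl⟩
      exact ⟨v.1, rfl⟩
  · simp only [Store.setRoot, Store.setLabel, Store.delNode, Store.delEdge]
    by_cases h2 : a = ε e
    · subst h2
      rw [Function.update_self]
      exact iff_of_false (fun h => h rfl) fun ⟨v, hv⟩ => v.2 (hS.edge_inj hv)
    rw [Function.update_of_ne h2, hS.edge_ne_none]
    constructor
    · rintro ⟨v, rfl⟩
      exact ⟨⟨v, fun h => h2 (congrArg ε h)⟩, rfl⟩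
    · rintro ⟨v, rfl⟩
      exact ⟨v.1, rfl⟩
  · simp only [Store.setRoot, Store.setLabel, Store.delNode, Store.delEdge, pruneGraph]
    by_cases h1 : v.1 = G.src e
    · exact ⟨.square, true, if_pos h1, if_pos h1, by rw [h1, Function.update_self]⟩
    rw [if_neg h1, if_neg h1, Function.update_of_ne (hS.node_inj.ne h1),
      Function.update_of_ne (hS.node_inj.ne h1), Function.update_of_ne (hS.node_inj.ne v.2)]
    exact hS.node_eq v.1
  · simp only [Store.setRoot, Store.setLabel, Store.delNode, Store.delEdge, pruneGraph]
    rw [Function.update_of_ne (hS.edge_inj.ne e'.2)]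
    exact hS.edge_eq e'.1
  · simp only [Store.setRoot, Store.setLabel, Store.delNode, Store.delEdge]
    obtain ⟨hn, hm⟩ := hS.out_eq v.1
    by_cases h1 : v.1 = G.src e
    · rw [h1] at hn hm ⊢
      rw [Function.update_self]
      refine ⟨hn.erase _, fun a => ?_⟩
      rw [hn.mem_erase_iff, hm]
      constructor
      · rintro ⟨h2, e', rfl, he'⟩
        exact ⟨⟨e', fun h => h2 (congrArg ε h)⟩, rfl, Subtype.ext (he'.trans h1.symm)⟩
      · rintro ⟨e', rfl, he'⟩
        exact ⟨hS.edge_inj.ne e'.2, e'.1, rfl, (congrArg Subtype.val he').trans h1⟩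
    · rw [Function.update_of_ne (hS.node_inj.ne h1)]
      refine ⟨hn, fun a => ?_⟩
      rw [hm]
      constructor
      · rintro ⟨e', rfl, he'⟩
        exact ⟨⟨e', fun h => h1 (he'.symm.trans (congrArg G.src h))⟩, rfl, Subtype.ext he'⟩
      · rintro ⟨e', rfl, he'⟩
        exact ⟨e'.1, rfl, congrArg Subtype.val he'⟩
  · simp only [Store.setRoot, Store.setLabel, Store.delNode, Store.delEdge]
    obtain ⟨hn, hm⟩ := hS.in_eq v.1
    rw [Function.update_of_ne (hS.node_inj.ne v.2)]
    refine ⟨hn, fun a => ?_⟩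
    rw [hm]
    constructor
    · rintro ⟨e', rfl, he'⟩
      exact ⟨⟨e', fun h => v.2 (he'.symm.trans (congrArg G.tgt h))⟩, rfl, Subtype.ext he'⟩
    · rintro ⟨e', rfl, he'⟩
      exact ⟨e'.1, rfl, congrArg Subtype.val he'⟩
  · simp only [Store.setRoot, Store.setLabel, Store.delNode, Store.delEdge, if_true,
      Bool.false_eq_true, if_false]
    refine List.nodup_cons.2 ⟨fun h => ?_, hS.roots_nodup.erase _⟩
    obtain ⟨v, hv, hv'⟩ := (hS.mem_roots _).1 (List.mem_of_mem_erase h)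
    rw [hS.node_inj hv, hr] at hv'
    cases hv'
  · simp only [Store.setRoot, Store.setLabel, Store.delNode, Store.delEdge, if_true,
      Bool.false_eq_true, if_false, List.mem_cons, hS.roots_nodup.mem_erase_iff, hS.mem_roots,
      pruneGraph]
    constructor
    · rintro (rfl | ⟨h1, v, rfl, hv⟩)
      · exact ⟨⟨G.src e, hne⟩, rfl, if_pos rfl⟩
      · exact (h1 (congrArg ν (((hu v).1 hv).trans htx.symm))).elim
    · rintro ⟨v, rfl, hv⟩
      split_ifs at hv with h1
      · exact Or.inl (congrArg ν h1)
      · exact (v.2 (((hu _).1 hv).trans htx.symm)).elim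

theorem CanPrune.deg_le {G : LGraph NodeLabel Blank} {e : G.E} (h : CanPrune G e)
    (v : (pruneGraph G e h.isPendant).V) : (pruneGraph G e h.isPendant).deg v ≤ G.deg v.1 := by
  refine Nat.add_le_add (Nat.card_le_card_of_injective
    (fun e' => ⟨e'.1.1, congrArg Subtype.val e'.2⟩) ?_) (Nat.card_le_card_of_injective
    (fun e' => ⟨e'.1.1, congrArg Subtype.val e'.2⟩) ?_)
  all_goals exact fun e₁ e₂ h' => Subtype.ext (Subtype.ext (Subtype.mk.inj h'))

/-! ### One round of the program -/

section Round

variable {G : LGraph NodeLabel Blank} {x : G.V} {S : Store NodeLabel Blank} {ν : G.V → ℕ}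
  {ε : G.E → ℕ}

/-- The two obstacles to pushing the root node `x` along an outgoing edge. -/
theorem canPush_or (hl : ∀ v, G.lab v ≠ none) (hr : ∀ v, G.root v ≠ none)
    (hx : G.lab x = some .square) (hx' : G.root x = some true) {e : G.E} (he : G.src e = x) :
    CanPush G e ∨ G.root (G.tgt e) = some true ∨ G.lab (G.tgt e) = some .triangle := by
  obtain ⟨a, ha⟩ := Option.ne_none_iff_exists'.1 (hl (G.tgt e))
  obtain ⟨p, hp⟩ := Option.ne_none_iff_exists'.1 (hr (G.tgt e))
  cases p
  · cases a
    · exact Or.inl ⟨he ▸ hx, ha, he ▸ hx', hp⟩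
    · exact Or.inr (Or.inr ha)
  · exact Or.inr (Or.inl hp)

/-- One round of the loop over the outgoing edges of the root node `x`. -/
theorem run_loop_round (ht : G.IsTLRG) (hx : G.lab x = some .square) (hx' : G.root x = some true)
    (hS : S.Holds G ν ε) {l₁ l₂ : List ℕ} {e : G.E} (hout : S.outAdj (ν x) = l₁ ++ ε e :: l₂)
    {nr er : ℕ → Option ℕ} (hnr : nr 0 = some (ν x)) (her : er 0 = some (ε e)) :
    (¬ CanPush G e ∧ ∃ k ≤ 6, ∃ nr', nr' 0 = some (ν x) ∧ treeProgram.run ⟨3, nr, er, S⟩ k =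
        some ⟨if l₂.head? = none then 17 else 3, nr', Function.update er 0 l₂.head?, S⟩) ∨
    CanPush G e ∧ ∃ nr' er', treeProgram.run ⟨3, nr, er, S⟩ 7 = some ⟨0, nr', er',
        ((S.setLabel (ν (G.src e)) ⟨.square, true⟩ .triangle).setRoot (ν (G.src e))
          ⟨.triangle, true⟩ false).setRoot (ν (G.tgt e)) ⟨.square, false⟩ true⟩ := by
  obtain ⟨hnd, hmem⟩ := hS.out_eq x
  have hsrc : G.src e = x := by
    obtain ⟨e', he', h⟩ := (hmem (ε e)).1 (by simp [hout])
    rwa [← hS.edge_inj he']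
  by_cases hc : CanPush G e
  · refine Or.inr ⟨hc, Function.update nr 1 (some (ν (G.tgt e))), er, ?_⟩
    rw [hsrc]
    obtain ⟨-, h2, -, h4⟩ := hc
    refine run_push hnr her (hS.edge_eq e) (hS.node_eq_of hx hx') (hS.node_eq_of h2 h4) rfl rfl ?_
    intro h
    rw [hS.node_inj h, hx'] at h4
    cases h4
  · refine Or.inl ⟨hc, ?_⟩
    obtain ⟨y, b, hy, hb, hm⟩ := hS.node_eq (G.tgt e)
    have hor : b = true ∨ y = .triangle := by
      have h := (canPush_or ht.1 ht.2 hx hx' hsrc).resolve_left hc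
      rwa [hy, hb, Option.some.injEq, Option.some.injEq] at h
    have hsucc : succIn (S.outAdj (ν (G.src e))) (ε e) = l₂.head? := by
      rw [hsrc, hout]
      rw [hout] at hnd
      exact succIn_append fun h => List.disjoint_of_nodup_append hnd h (by simp)
    have h := run_skip hnr her (hS.edge_eq e) hm hor
    simp only [hsucc] at h
    exact h

/-- The loop over the outgoing edges of the root node `x`, started at the edge with address `b`,
when no edge before it can be pushed along. -/
theorem run_loop (ht : G.IsTLRG) (hx : G.lab x = some .square) (hx' : G.root x = some true)
    (hS : S.Holds G ν ε) (l₁ l₂ : List ℕ) (b : ℕ) (hout : S.outAdj (ν x) = l₁ ++ b :: l₂)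
    (hno : ∀ e, ε e ∈ l₁ → ¬ CanPush G e) (nr er : ℕ → Option ℕ) (hnr : nr 0 = some (ν x))
    (her : er 0 = some b) :
    (∃ k ≤ 6 * (l₂.length + 1), ∃ nr' er', treeProgram.run ⟨3, nr, er, S⟩ k =
        some ⟨17, nr', er', S⟩ ∧ ∀ e, ε e ∈ S.outAdj (ν x) → ¬ CanPush G e) ∨
    ∃ k ≤ 6 * (l₂.length + 1) + 1, ∃ nr' er' e, 0 < k ∧ CanPush G e ∧
      treeProgram.run ⟨3, nr, er, S⟩ k = some ⟨0, nr', er',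
        ((S.setLabel (ν (G.src e)) ⟨.square, true⟩ .triangle).setRoot (ν (G.src e))
          ⟨.triangle, true⟩ false).setRoot (ν (G.tgt e)) ⟨.square, false⟩ true⟩ := by
  induction l₂ generalizing l₁ b nr er with
  | nil =>
    obtain ⟨e, rfl, -⟩ := ((hS.out_eq x).2 b).1 (by simp [hout])
    rcases run_loop_round ht hx hx' hS hout hnr her with ⟨hc, k, hk, nr', -, h⟩ | ⟨hc, nr', er', h⟩
    · refine Or.inl ⟨k, by simpa using hk, nr', _, h, fun e' he' => ?_⟩
      rw [hout, List.mem_append, List.mem_singleton] at he'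
      rcases he' with he' | he'
      · exact hno _ he'
      · rwa [hS.edge_inj he']
    · exact Or.inr ⟨7, by simp, nr', er', e, by simp, hc, h⟩
  | cons b' l₂ ih =>
    obtain ⟨e, rfl, -⟩ := ((hS.out_eq x).2 b).1 (by simp [hout])
    rcases run_loop_round ht hx hx' hS hout hnr her with ⟨hc, k, hk, nr', hn, h⟩ | ⟨hc, nr', er', h⟩
    · have hno' : ∀ e', ε e' ∈ l₁ ++ [ε e] → ¬ CanPush G e' := by
        intro e' he'
        rw [List.mem_append, List.mem_singleton] at he'
        rcases he' with he' | he'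
        · exact hno _ he'
        · rwa [hS.edge_inj he']
      rw [List.head?_cons, if_neg (Option.some_ne_none _)] at h
      rcases ih (l₁ ++ [ε e]) b' (by simp [hout]) hno' nr' _ hn (Function.update_self ..) with
        ⟨k', hk', nr'', er'', h', h''⟩ | ⟨k', hk', nr'', er'', e', h0, hc', h'⟩
      · refine Or.inl ⟨k + k', ?_, nr'', er'', (Program.run_add h k').trans h', h''⟩
        rw [List.length_cons]
        omega
      · refine Or.inr ⟨k + k', ?_, nr'', er'', e', by omega, hc', (Program.run_add h k').trans h'⟩
        rw [List.length_cons]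
        omega
    · exact Or.inr ⟨7, by rw [List.length_cons]; omega, nr', er', e, by simp, hc, h⟩

end Round

/-- From the start of a round, the program either finds out that no rule applies and halts, or
performs one step, and it needs time linear in the degree of the root node. -/
theorem run_round {G : LGraph NodeLabel Blank} (hG : IsSingleRooted G)
    {S : Store NodeLabel Blank} (hS : S.Represents G) (nr er : ℕ → Option ℕ) :
    (InNormalForm treeRules G ∧ ∃ n nr' er',
      treeProgram.run ⟨0, nr, er, S⟩ n = some ⟨17, nr', er', S⟩ ∧
      ∀ d, (∀ v, G.deg v ≤ d) → n ≤ 6 * d + 13) ∨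
    ∃ n M nr' er' S', 0 < n ∧ treeProgram.run ⟨0, nr, er, S⟩ n = some ⟨0, nr', er', S'⟩ ∧
      Step treeRules G M ∧ S'.Represents M ∧ IsSingleRooted M ∧
      ∀ d, (∀ v, G.deg v ≤ d) → n ≤ 6 * d + 13 ∧ ∀ v, M.deg v ≤ d := by
  obtain ⟨ht, x, hx, hu⟩ := id hG
  obtain ⟨ν, ε, hS⟩ := Store.represents_iff.1 hS
  have hx' := (hu x).2 rfl
  have hnode := hS.node_eq_of hx hx'
  have hroots : S.roots = [ν x] := by
    refine List.perm_singleton.1 ((List.perm_ext_iff_of_nodup hS.roots_nodup (by simp)).2 ?_)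
    intro a
    simp [hS.mem_roots, hu, eq_comm]
  have hstart := run_start (nr := nr) (er := er) hroots hnode
  have hlen := hS.length_outAdj_le x
  -- Rules apply only to edges that are incident to the root node.
  have push_out : ∀ e, CanPush G e → ε e ∈ S.outAdj (ν x) := fun e he =>
    ((hS.out_eq x).2 _).2 ⟨e, rfl, (hu _).1 he.2.2.1⟩
  have prune_in : ∀ e, CanPrune G e → S.outAdj (ν x) = [] ∧ S.inAdj (ν x) = [ε e] := by
    intro e he
    have hte : G.tgt e = x := (hu _).1 he.2.2.2.1
    constructor
    · refine List.eq_nil_iff_forall_not_mem.2 fun a ha => ?_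
      obtain ⟨e', rfl, he'⟩ := ((hS.out_eq x).2 a).1 ha
      by_cases h : e' = e
      · exact he.src_ne_tgt ((h ▸ he').trans hte.symm)
      · exact (he.isPendant e' h).1 (he'.trans hte.symm)
    · refine List.perm_singleton.1 ((List.perm_ext_iff_of_nodup (hS.in_eq x).1 (by simp)).2 ?_)
      intro a
      rw [(hS.in_eq x).2, List.mem_singleton]
      constructor
      · rintro ⟨e', rfl, he'⟩
        by_contra h
        exact (he.isPendant e' fun h' => h (congrArg ε h')).2 (he'.trans hte.symm)
      · rintro rfl
        exact ⟨e, rfl, hte⟩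
  rcases hout : S.outAdj (ν x) with _ | ⟨b, l⟩
  · have no_push : ∀ e, ¬ CanPush G e := fun e he => by simpa [hout] using push_out e he
    have no_out : ∀ e, G.src e ≠ x := fun e he => by
      simpa [hout] using ((hS.out_eq x).2 (ε e)).2 ⟨e, rfl, he⟩
    rw [hout, if_pos rfl] at hstart
    rcases hin : S.inAdj (ν x) with _ | ⟨b, _ | ⟨b', l⟩⟩
    · refine Or.inl ⟨inNormalForm_iff.2 fun e => ⟨no_push e, fun he => ?_⟩, 3 + 2, _, _,
        (Program.run_add hstart 2).trans (run_noIn (by simp) hnode hin), fun d _ => by omega⟩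
      simpa [hin] using (prune_in e he).2
    · obtain ⟨e, rfl, hte⟩ := ((hS.in_eq x).2 b).1 (by simp [hin])
      have hse := no_out e
      obtain ⟨y, p, hy, hp, hm⟩ := hS.node_eq (G.src e)
      obtain rfl : p = false := by
        by_contra h
        exact hse ((hu _).1 (by rw [hp, Bool.eq_true_of_not_eq_false h]))
      have hc : CanPrune G e := by
        refine ⟨by simp [hy], hte ▸ hx, hp, hte ▸ hx', fun e' he' => ⟨hte ▸ no_out e', ?_⟩⟩
        intro h
        have := ((hS.in_eq x).2 (ε e')).2 ⟨e', rfl, h.trans hte⟩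
        rw [hin, List.mem_singleton] at this
        exact he' (hS.edge_inj this)
      refine Or.inr ⟨3 + 10, _, _, _, _, by simp, (Program.run_add hstart 10).trans (run_prune
        (by simp) hnode hin (hS.edge_eq e) (by rw [hte]) hm (hS.node_inj.ne hse)), hc.step,
        Store.represents_iff.2 ⟨fun v => ν v.1, fun e' => ε e'.1, ?_⟩, hc.isSingleRooted hG,
        fun d hd => ⟨by omega, fun v => (hc.deg_le v).trans (hd _)⟩⟩
      rw [← hte]
      exact hc.holds hG hS
    · obtain ⟨e, rfl, hte⟩ := ((hS.in_eq x).2 b).1 (by simp [hin])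
      refine Or.inl ⟨inNormalForm_iff.2 fun e => ⟨no_push e, fun he => ?_⟩, 3 + 4, _, _,
        (Program.run_add hstart 4).trans (run_twoIn (by simp) hnode hin (hS.edge_eq e)
          (by rw [hte])), fun d _ => by omega⟩
      simpa [hin] using (prune_in e he).2
  · have no_prune : ∀ e, ¬ CanPrune G e := fun e he => by simpa [hout] using (prune_in e he).1
    rw [hout, if_neg (List.cons_ne_nil _ _)] at hstart
    rw [hout, List.length_cons] at hlen
    rcases run_loop ht hx hx' hS [] l b hout (by simp) _ _ (Function.update_self ..)
      (Function.update_self ..) with ⟨k, hk, nr', er', h, hno⟩ | ⟨k, hk, nr', er', e, h0, hc, h⟩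
    · refine Or.inl ⟨inNormalForm_iff.2 fun e => ⟨fun he => hno e (push_out e he) he, no_prune e⟩,
        3 + k, nr', er', (Program.run_add hstart k).trans h, fun d hd => ?_⟩
      have := hd x
      omega
    · refine Or.inr ⟨3 + k, _, nr', er', _, by omega, (Program.run_add hstart k).trans h, hc.step,
        Store.represents_iff.2 ⟨ν, ε, hc.holds hG hS⟩, hc.isSingleRooted hG, fun d hd => ⟨?_, hd⟩⟩
      have := hd x
      omega

/-! ### The whole run -/

theorem derives_of_steps {rs : Set (Rule LV LE)} {k : ℕ} {D : ℕ → LGraph LV LE}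
    (h : ∀ i < k, Step rs (D i) (D (i + 1))) : Derives rs (D 0) (D k) := by
  have : Relation.ReflTransGen (Step rs) (D 0) (D k) := by
    induction k with
    | zero => exact .refl
    | succ k ih => exact (ih fun i hi => h i (by omega)).tail (h k (by omega))
  rcases Relation.reflTransGen_iff_eq_or_transGen.1 this with h | h
  · exact Or.inl (h ▸ Iso.refl _)
  · exact Or.inr h

/-- A step decreases the weight, so the time is at most the weight times the time of a round. -/
theorem run_normalForm {G : LGraph NodeLabel Blank} (hG : IsSingleRooted G)
    {S : Store NodeLabel Blank} (hS : S.Represents G) (nr er : ℕ → Option ℕ) :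
    ∃ (n k : ℕ) (D : ℕ → LGraph NodeLabel Blank) (τ : ℕ → ℕ) (c : Config NodeLabel Blank),
      treeProgram.run ⟨0, nr, er, S⟩ n = some c ∧ c.pc = 17 ∧ c.store.Represents (D k) ∧
      InNormalForm treeRules (D k) ∧ D 0 = G ∧ τ 0 = 0 ∧ τ k ≤ n ∧
      (∀ i < k, Step treeRules (D i) (D (i + 1)) ∧ τ i < τ (i + 1)) ∧
      (∀ i ≤ k, ∃ c', treeProgram.run ⟨0, nr, er, S⟩ (τ i) = some c' ∧
        c'.store.Represents (D i)) ∧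
      ∀ d, (∀ v, G.deg v ≤ d) → n ≤ (weight G + 1) * (6 * d + 13) := by
  induction hw : weight G using Nat.strong_induction_on generalizing G S nr er with
  | _ w ih =>
    rcases run_round hG hS nr er with
      ⟨hnf, n, nr', er', h, ht⟩ | ⟨n, M, nr', er', S', hn, h, hstep, hS', hM, ht⟩
    · refine ⟨n, 0, fun _ => G, fun _ => 0, _, h, rfl, hS, hnf, rfl, rfl, Nat.zero_le _, by simp,
        fun i _ => ⟨_, rfl, hS⟩, fun d hd => (ht d hd).trans ?_⟩
      exact Nat.le_mul_of_pos_left _ (Nat.succ_pos _)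
    · have hlt := hstep.weight_lt
      obtain ⟨m, k, D, τ, c, h1, h2, h3, h4, h5, h6, h7, h8, h9, h10⟩ :=
        ih _ (hw ▸ hlt) hM hS' nr' er' rfl
      refine ⟨n + m, k + 1, fun i => i.casesOn G D, fun i => i.casesOn 0 fun i => n + τ i, c,
        (Program.run_add h m).trans h1, h2, h3, h4, rfl, rfl, Nat.add_le_add_left h7 n, ?_, ?_, ?_⟩
      · rintro (_ | i) hi
        · refine ⟨?_, ?_⟩
          · change Step treeRules G (D 0)
            rwa [h5]
          · change 0 < n + τ 0
            omega
        · exact ⟨(h8 i (by omega)).1, Nat.add_lt_add_left (h8 i (by omega)).2 n⟩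
      · rintro (_ | i) hi
        · exact ⟨_, rfl, hS⟩
        · obtain ⟨c', hc, hc'⟩ := h9 i (by omega)
          exact ⟨c', (Program.run_add h _).trans hc, hc'⟩
      · intro d hd
        have h11 := h10 d (ht d hd).2
        have h12 := (ht d hd).1
        have h13 : (weight M + 1 + 1) * (6 * d + 13) ≤ (w + 1) * (6 * d + 13) :=
          Nat.mul_le_mul_right _ (by omega)
        rw [Nat.succ_mul (weight M + 1)] at h13
        omega

/-- The time bound `3 * (6 * d + 13)` comes from `weight_le` and the fact that an input graph has a
node. -/
theorem treeProgram_runsSystem {G : LGraph NodeLabel Blank} (hG : IsInputGraph G)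
    {S : Store NodeLabel Blank} (hS : S.Represents G) :
    ∃ (H : LGraph NodeLabel Blank) (n : ℕ),
      treeProgram.RunsSystem treeRules S G H n ∧ IsNormalFormOf treeRules G H ∧
      ∀ d : ℕ, (∀ v, G.deg v ≤ d) → n ≤ 3 * (6 * d + 13) * Nat.card G.V := by
  obtain ⟨n, k, D, τ, c, h1, h2, h3, h4, h5, h6, h7, h8, h9, h10⟩ :=
    run_normalForm hG.isSingleRooted hS (fun _ => none) fun _ => none
  refine ⟨D k, n, ⟨⟨c.store, ⟨c, ?_, by rw [h2]; rfl, rfl⟩, h3⟩, k, D, τ, h5, rfl, h6, h7, h8,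
    fun i hi => ?_⟩, ⟨h5 ▸ derives_of_steps fun i hi => (h8 i hi).1, h4⟩, fun d hd => ?_⟩
  · rw [Program.after_eq_run]
    exact h1
  · obtain ⟨c', hc, hc'⟩ := h9 i hi
    exact ⟨c', (Program.after_eq_run _ _ _).trans hc, hc'⟩
  · obtain ⟨-, -, x, -⟩ := hG
    have : Nonempty G.V := ⟨x⟩
    have hpos : 0 < Nat.card G.V := Nat.card_pos
    have hw := weight_le G
    calc n ≤ (weight G + 1) * (6 * d + 13) := h10 d hd
      _ ≤ (3 * Nat.card G.V) * (6 * d + 13) := Nat.mul_le_mul_right _ (by omega)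
      _ = 3 * (6 * d + 13) * Nat.card G.V := by ring

end GT

theorem mainTheorem3 :
    (∀ G : GT.LGraph GT.NodeLabel GT.Blank, GT.IsInputGraph G →
      (¬ ∃ D : ℕ → GT.LGraph GT.NodeLabel GT.Blank,
          D 0 = G ∧ ∀ i, GT.Step GT.treeRules (D i) (D (i + 1))) ∧
      (∃ H, GT.IsNormalFormOf GT.treeRules G H) ∧
      (∀ H, GT.IsNormalFormOf GT.treeRules G H →
        (GT.Iso H GT.singleRoot ↔ GT.strip G ∈ GT.treeGrammar.language)) ∧
      (∀ (k : ℕ) (D : ℕ → GT.LGraph GT.NodeLabel GT.Blank), D 0 = G →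
        (∀ i < k, GT.Step GT.treeRules (D i) (D (i + 1))) → k ≤ 2 * Nat.card G.V)) ∧
    ∃ (P : GT.Program GT.NodeLabel GT.Blank) (C : ℕ → ℕ),
      ∀ G : GT.LGraph GT.NodeLabel GT.Blank, GT.IsInputGraph G →
        ∀ S : GT.Store GT.NodeLabel GT.Blank, S.Represents G →
          ∃ (H : GT.LGraph GT.NodeLabel GT.Blank) (n : ℕ),
            P.RunsSystem GT.treeRules S G H n ∧ GT.IsNormalFormOf GT.treeRules G H ∧
            ∀ d : ℕ, (∀ v, G.deg v ≤ d) → n ≤ C d * Nat.card G.V := by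
  refine ⟨fun G hG => ⟨?_, GT.exists_normalForm G, fun H hH => GT.iso_singleRoot_iff hG hH, ?_⟩,
    GT.treeProgram, fun d => 3 * (6 * d + 13), fun G hG S hS => GT.treeProgram_runsSystem hG hS⟩
  · rintro ⟨D, -, hD⟩
    have := GT.add_weight_le_of_steps (k := GT.weight (D 0) + 1) fun i _ => hD i
    omega
  · rintro k D rfl hD
    have := GT.add_weight_le_of_steps hD
    have := GT.weight_le (D 0)
    omega
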